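/- Consider a discounted Markov decision process with measurable state space $\mathcal S$ and action space $\mathcal A$, transition kernel $\mathcal P(\cdot\mid s,a)$, measurable reward $\mathcal R(s,a)\in[-\mathcal R_{\max},\mathcal R_{\max}]$, discount factor $\gamma\in[0,1)$ and initial state distribution $\rho$. Let $\{\pi_\theta:\theta\in\mathbb R^d\}$ be stochastic policies, where $\pi_\theta(\cdot\mid s)$ is a probability density with respect to a $\sigma$-finite reference measure $\mu$ on $\mathcal A$, and $\pi_\theta(a\mid s)>0$ is twice differentiable in $\theta$ for all $(s,a)$. Let $$J(\theta)=\mathbb E\Big[\sum_{t=0}^\infty\gamma^t\mathcal R(s_t,a_t)\Big],\qquad s_0\sim\rho,\ a_t\sim\pi_\theta(\cdot\mid s_t),\ s_{t+1}\sim\mathcal P(\cdot\mid s_t,a_t),$$ be the expected return. Assume (E-LS): there are constants $G,F>0$ such that for every $\theta\in\mathbb R^d$ and every $s\in\mathcal S$ $$\mathbb E_{a\sim\pi_\theta(\cdot\mid s)}\big[\|\nabla_\theta\log\pi_\theta(a\mid s)\|^2\big]\le G^2,\qquad \mathbb E_{a\sim\pi_\theta(\cdot\mid s)}\big[\|\nabla^2_\theta\log\pi_\theta(a\mid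 s)\|\big]\le F,$$ where matrices carry the operator norm. Then $J$ is $L$-smooth with $$L=\frac{\mathcal R_{\max}}{(1-\gamma)^2}\,(G^2+F).$$ That is, $J$ is differentiable on $\mathbb R^d$ and, for all $\theta,\theta'\in\mathbb R^d$, $$\|\nabla J(\theta')-\nabla J(\theta)\|\le L\|\theta'-\theta\|,\qquad \big|J(\theta')-J(\theta)-\langle\nabla J(\theta),\theta'-\theta\rangle\big|\le\tfrac L2\|\theta'-\theta\|^2 ;$$ and $\|\nabla^2J(\theta)\|\le L$ at every $\theta$ at which $\nabla J$ is differentiable. The gradient $\nabla J$ is differentiable at Lebesgue-almost every $\theta$, and at every $\theta$ near which the Hessians of the densities are dominated, i.e. such that for each $s$ there are a neighbourhood $U$ of $\theta$ and a $\mu$-integrable function $g$ on $\mathcal A$ with $\|\nabla^2_{\theta}\pi_{\theta'}(a\mid s)\|\le g(a)$ for all $\theta'\in U$ and $\mu$-almost every $a$. -/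

import Mathlib

open MeasureTheory ProbabilityTheory Filter Topology
open scoped ENNReal Gradient

noncomputable section

/-- A discounted Markov decision process: transition kernel `P(ds' | s, a)`, measurable reward
`R(s, a) ∈ [-Rmax, Rmax]`, discount factor `γ ∈ [0, 1)`, initial state distribution `ρ`. -/
structure MDP (S A : Type*) [MeasurableSpace S] [MeasurableSpace A] where
  P : Kernel (S × A) S
  isMarkovKernel_P : IsMarkovKernel P
  R : S → A → ℝ
  Rmax : ℝ
  measurable_R : Measurable (Function.uncurry R)
  abs_R_le : ∀ s a, |R s a| ≤ Rmax
  γ : ℝ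
  γ_nonneg : 0 ≤ γ
  γ_lt_one : γ < 1
  ρ : Measure S
  isProbabilityMeasure_ρ : IsProbabilityMeasure ρ

/-- A stochastic policy: `dens s a` is the density `π(a | s)`, with respect to the reference
measure `μ` on actions, of the law of the action taken in state `s`. -/
structure Policy (S : Type*) {A : Type*} [MeasurableSpace S] [MeasurableSpace A]
    (μ : Measure A) where
  dens : S → A → ℝ
  measurable_dens : Measurable (Function.uncurry dens)
  dens_nonneg : ∀ s a, 0 ≤ dens s a
  lintegral_dens : ∀ s, ∫⁻ a, ENNReal.ofReal (dens s a) ∂μ = 1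

section Return

variable {S A : Type*} [MeasurableSpace S] [MeasurableSpace A] {μ : Measure A} [SigmaFinite μ]

/-- The law `π(· | s)` of the action in state `s`, as a kernel. -/
def Policy.kernel (π : Policy S μ) : Kernel S A :=
  (Kernel.const S μ).withDensity fun s a => ENNReal.ofReal (π.dens s a)

theorem Policy.kernel_apply (π : Policy S μ) (s : S) :
    π.kernel s = μ.withDensity fun a => ENNReal.ofReal (π.dens s a) := by
  have h : Measurable (Function.uncurry fun s a => ENNReal.ofReal (π.dens s a)) :=
    π.measurable_dens.ennreal_ofReal
  rw [Policy.kernel, Kernel.withDensity_apply _ h, Kernel.const_apply]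

instance Policy.isMarkovKernel_kernel (π : Policy S μ) : IsMarkovKernel π.kernel :=
  ⟨fun s => ⟨by
    rw [π.kernel_apply, withDensity_apply _ MeasurableSet.univ, Measure.restrict_univ,
      π.lintegral_dens]⟩⟩

instance MDP.instIsMarkovKernelP (M : MDP S A) : IsMarkovKernel M.P := M.isMarkovKernel_P

instance MDP.instIsProbabilityMeasureρ (M : MDP S A) : IsProbabilityMeasure M.ρ :=
  M.isProbabilityMeasure_ρ

/-- One step of the state-action chain: from `(s, a)`, draw `s' ∼ P(· | s, a)`, then
`a' ∼ π(· | s')`. -/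
def MDP.step (M : MDP S A) (π : Policy S μ) : Kernel (S × A) (S × A) :=
  M.P ⊗ₖ Kernel.prodMkLeft (S × A) π.kernel

instance MDP.isMarkovKernel_step (M : MDP S A) (π : Policy S μ) : IsMarkovKernel (M.step π) := by
  unfold MDP.step; infer_instance

/-- The law of `(s_{n+1}, a_{n+1})` given the history up to time `n`; it depends on the history
only through `(s_n, a_n)`. -/
def MDP.historyStep (M : MDP S A) (π : Policy S μ) (n : ℕ) :
    Kernel ((i : Finset.Iic n) → (fun _ : ℕ => S × A) i) (S × A) :=
  (M.step π).comap (fun h => h ⟨n, Finset.mem_Iic.2 le_rfl⟩) (measurable_pi_apply _)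

instance MDP.isMarkovKernel_historyStep (M : MDP S A) (π : Policy S μ) (n : ℕ) :
    IsMarkovKernel (M.historyStep π n) := by
  unfold MDP.historyStep; infer_instance

/-- The law `p(τ | π)` of an infinite trajectory `τ = (s₀, a₀, s₁, a₁, …)`: `s₀ ∼ ρ`,
`a_t ∼ π(· | s_t)`, `s_{t+1} ∼ P(· | s_t, a_t)` (Ionescu-Tulcea). -/
def MDP.trajectoryLaw (M : MDP S A) (π : Policy S μ) : Measure (ℕ → S × A) :=
  Kernel.trajMeasure (X := fun _ => S × A) (M.ρ ⊗ₘ π.kernel) (M.historyStep π)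

/-- The total discounted reward `∑ₜ γᵗ R(sₜ, aₜ)` along a trajectory (an absolutely convergent
series, the reward being bounded). -/
def MDP.discountedReward (M : MDP S A) (τ : ℕ → S × A) : ℝ :=
  ∑' t : ℕ, M.γ ^ t * M.R (τ t).1 (τ t).2

/-- The expected return `J(π)`. -/
def MDP.expectedReturn (M : MDP S A) (π : Policy S μ) : ℝ :=
  ∫ τ, M.discountedReward τ ∂(M.trajectoryLaw π)

end Return

section Smoothness

variable {d : ℕ}

/-- The Hessian `∇²f(θ)` as a linear operator on `ℝᵈ`, normed by the operator (spectral) norm. -/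
def hessian (f : EuclideanSpace ℝ (Fin d) → ℝ) (θ : EuclideanSpace ℝ (Fin d)) :
    EuclideanSpace ℝ (Fin d) →L[ℝ] EuclideanSpace ℝ (Fin d) :=
  fderiv ℝ (∇ f) θ

/-- `f` is twice differentiable at every point of `ℝᵈ`. -/
def TwiceDifferentiable (f : EuclideanSpace ℝ (Fin d) → ℝ) : Prop :=
  Differentiable ℝ f ∧ Differentiable ℝ (∇ f)

variable {S A : Type*} [MeasurableSpace S] [MeasurableSpace A] {μ : Measure A} [SigmaFinite μ]

/-- A policy family `(π_θ)`, `θ ∈ ℝᵈ`, for which `log π_θ(a | s)` makes sense and has a gradient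
and a Hessian in `θ`: densities are positive and twice differentiable in the parameter. -/
structure IsRegularFamily (π : EuclideanSpace ℝ (Fin d) → Policy S μ) : Prop where
  dens_pos : ∀ θ s a, 0 < (π θ).dens s a
  twiceDifferentiable : ∀ s a, TwiceDifferentiable fun θ => (π θ).dens s a

/-- Expected Lipschitz and smooth policies (E-LS), with constants `G` and `F`. The expectations
are those of nonnegative functions, so they are taken in `[0, ∞]`. -/
structure IsExpectedLipschitzSmooth (π : EuclideanSpace ℝ (Fin d) → Policy S μ) (G F : ℝ) :
    Prop where
  G_pos : 0 < G
  F_pos : 0 < F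
  gradient_le : ∀ θ s,
    ∫⁻ a, ‖(∇ (fun θ' => Real.log ((π θ').dens s a))) θ‖ₑ ^ 2 ∂((π θ).kernel s)
      ≤ ENNReal.ofReal (G ^ 2)
  hessian_le : ∀ θ s,
    ∫⁻ a, ‖hessian (fun θ' => Real.log ((π θ').dens s a)) θ‖ₑ ∂((π θ).kernel s)
      ≤ ENNReal.ofReal F

/-- Near `θ`, the Hessians of the densities are dominated by an integrable function of the action,
for each state (the usual condition for differentiating `∫ π_θ(a | s) f(a) μ(da)` twice
under the integral sign). -/
def HessianLocallyDominated (π : EuclideanSpace ℝ (Fin d) → Policy S μ)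
    (θ : EuclideanSpace ℝ (Fin d)) : Prop :=
  ∀ s, ∃ U ∈ 𝓝 θ, ∃ g : A → ℝ, Integrable g μ ∧
    ∀ᵐ a ∂μ, ∀ θ' ∈ U, ‖hessian (fun θ'' => (π θ'').dens s a) θ'‖ ≤ g a

end Smoothness

end

/-!
The return is `J(θ) = ∑ₜ γᵗ E_θ[R(sₜ, aₜ)]`, and each term is the expectation of a bounded function
under a law with a density that is smooth in `θ`: with respect to the measure obtained from the
initial law, the transition kernel and the reference measure `μ`, the history up to time `t` has
density `q_θ = ∏_{k ≤ t} π_θ(a_k | s_k)`. Its score is `∑_{k ≤ t} ∇ log π_θ(a_k | s_k)`. The summands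
are conditionally centred, hence orthogonal, so the second moment of the score is at most
`(t + 1) G²`; likewise the first moment of the log-Hessian is at most `(t + 1) F`
(`IsSmoothDensityFamily.compProd`, `isSmoothMarginal_marginal`).

Since `∇²q = q (∇² log q + ∇ log q ⊗ ∇ log q)`, the Hessians of `q_θ` are bounded in `L¹` by
`(t + 1)(G² + F)`, uniformly in `θ`. The Hessians need be neither continuous nor dominated, but by
the fundamental theorem of calculus on segments and Tonelli's theorem this bound makes `θ ↦ ∇q_θ`
Lipschitz into `L¹` (`IsSmoothDensityFamily.lintegral_gradient_sub_le`). So `E_θ[R(sₜ, aₜ)]` has a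
gradient that is Lipschitz with constant `Rmax (t + 1)(G² + F)`, and
`∑ₜ (t + 1) γᵗ = 1 / (1 - γ)²` gives the constant `L`. The almost everywhere existence of the Hessian
of `J` is Rademacher's theorem, and its bound is the Lipschitz bound.

Where the Hessians of the policy are locally dominated, second-order differentiability comes from
backward induction. Conditioning on the first state and action,
`E_{θ,s}[R_{t+1}] = ∫ π_θ(a | s) E_{θ,P(s,a)}[R_t] μ(da)`, where the second factor has a Lipschitz
gradient with a constant that does not depend on `(s, a)`. One can then differentiate twice under the
integrals over `a`, over the state, and finally over time
(`differentiableAt_gradient_integral`, `MDP.differentiableAt_gradient_rewardAt`).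
-/

open scoped NNReal

noncomputable section

/-! ### Gradients, Hessians of logarithms, and measurability in a parameter -/

theorem tendsto_inv_natCast_add_one_nhdsNE_zero :
    Tendsto (fun n : ℕ => ((n : ℝ) + 1)⁻¹) atTop (𝓝[≠] 0) := by
  refine tendsto_nhdsWithin_iff.2 ⟨?_, Eventually.of_forall fun n => ?_⟩
  · simpa using tendsto_one_div_add_atTop_nhds_zero_nat (𝕜 := ℝ)
  · simp only [Set.mem_compl_iff, Set.mem_singleton_iff]
    positivity

/-- In finite dimension, the derivative in the parameter of a function that is measurable for each
value of the parameter is measurable: along each basis vector it is a limit of difference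
quotients. -/
theorem measurable_fderiv_of_measurable {E Ω : Type*} [NormedAddCommGroup E]
    [InnerProductSpace ℝ E] [FiniteDimensional ℝ E] [MeasurableSpace Ω] {F : Type*}
    [NormedAddCommGroup F] [NormedSpace ℝ F] [SecondCountableTopology F] [MeasurableSpace F]
    [BorelSpace F] {f : E → Ω → F} (hf : ∀ x, Measurable (f x)) {x : E}
    (hd : ∀ ω, DifferentiableAt ℝ (fun y => f y ω) x) :
    Measurable fun ω => fderiv ℝ (fun y => f y ω) x := by
  let b := stdOrthonormalBasis ℝ E
  have hc : ∀ i, Measurable fun ω => fderiv ℝ (fun y => f y ω) x (b i) := by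
    intro i
    have hlim : ∀ ω, Tendsto
        (fun n : ℕ => (((n : ℝ) + 1)⁻¹)⁻¹ • (f (x + ((n : ℝ) + 1)⁻¹ • b i) ω - f x ω))
        atTop (𝓝 (fderiv ℝ (fun y => f y ω) x (b i))) := by
      intro ω
      have h1 : HasDerivAt (fun t : ℝ => x + t • b i) (b i) 0 := by
        simpa using ((hasDerivAt_id (0 : ℝ)).smul_const (b i)).const_add x
      have h2 : HasDerivAt (fun t : ℝ => f (x + t • b i) ω)
          (fderiv ℝ (fun y => f y ω) x (b i)) 0 := by
        have h : HasFDerivAt (fun y => f y ω) (fderiv ℝ (fun y => f y ω) x)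
            (x + (0 : ℝ) • b i) := by simpa using (hd ω).hasFDerivAt
        exact h.comp_hasDerivAt (0 : ℝ) h1
      simpa [Function.comp_def] using
        h2.tendsto_slope_zero.comp tendsto_inv_natCast_add_one_nhdsNE_zero
    exact measurable_of_tendsto_metrizable
      (fun n => ((hf _).sub (hf x)).const_smul (((n : ℝ) + 1)⁻¹)⁻¹) (tendsto_pi_nhds.2 hlim)
  have : (fun ω => fderiv ℝ (fun y => f y ω) x)
      = fun ω => ∑ i, ContinuousLinearMap.smulRightL ℝ E F (innerSL ℝ (b i))
          (fderiv ℝ (fun y => f y ω) x (b i)) := by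
    ext ω v
    conv_lhs => rw [← b.sum_repr' v]
    simp
  rw [this]
  exact Finset.measurable_sum _ fun i _ =>
    (ContinuousLinearMap.continuous _).measurable.comp (hc i)

section Calculus

variable {E : Type*} [NormedAddCommGroup E] [InnerProductSpace ℝ E] [CompleteSpace E]

theorem gradient_fun_mul {f g : E → ℝ} {x : E} (hf : DifferentiableAt ℝ f x)
    (hg : DifferentiableAt ℝ g x) :
    (∇ fun y => f y * g y) x = f x • (∇ g) x + g x • (∇ f) x := by
  refine HasGradientAt.gradient ?_
  rw [hasGradientAt_iff_hasFDerivAt]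
  exact (hf.hasFDerivAt.mul hg.hasFDerivAt).congr_fderiv (by simp [gradient])

theorem gradient_eq_smul_gradient_log {f : E → ℝ} {x : E} (hf : DifferentiableAt ℝ f x)
    (hx : f x ≠ 0) : (∇ f) x = f x • (∇ fun y => Real.log (f y)) x := by
  have : HasGradientAt (fun y => Real.log (f y)) ((f x)⁻¹ • (∇ f) x) x := by
    rw [hasGradientAt_iff_hasFDerivAt]
    exact (hf.hasFDerivAt.log hx).congr_fderiv (by simp [gradient])
  rw [this.gradient, smul_inv_smul₀ hx]

theorem gradient_fun_log {f : E → ℝ} {x : E} (hf : DifferentiableAt ℝ f x)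
    (hx : f x ≠ 0) : (∇ fun y => Real.log (f y)) x = (f x)⁻¹ • (∇ f) x := by
  rw [gradient_eq_smul_gradient_log hf hx, inv_smul_smul₀ hx]

theorem gradient_fun_add {f g : E → ℝ} {x : E} (hf : DifferentiableAt ℝ f x)
    (hg : DifferentiableAt ℝ g x) :
    (∇ fun y => f y + g y) x = (∇ f) x + (∇ g) x := by
  refine HasGradientAt.gradient ?_
  rw [hasGradientAt_iff_hasFDerivAt]
  exact (hf.hasFDerivAt.add hg.hasFDerivAt).congr_fderiv (by simp [gradient])

/-- `∇²f = f (∇² log f + ∇ log f ⊗ ∇ log f)`, in norm. -/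
theorem norm_fderiv_gradient_le_of_log {f : E → ℝ} (hf : Differentiable ℝ f)
    (hf' : Differentiable ℝ (∇ f)) (hpos : ∀ y, 0 < f y) (x : E) :
    ‖fderiv ℝ (∇ f) x‖ ≤ f x * ‖(∇ fun y => Real.log (f y)) x‖ ^ 2
      + f x * ‖fderiv ℝ (∇ fun y => Real.log (f y)) x‖ := by
  set l : E → E := ∇ fun y => Real.log (f y) with hl
  have hfl : ∇ f = fun y => f y • l y :=
    funext fun y => gradient_eq_smul_gradient_log (hf y) (hpos y).ne'
  have hl' : Differentiable ℝ l := by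
    have : l = fun y => (f y)⁻¹ • (∇ f) y :=
      funext fun y => gradient_fun_log (hf y) (hpos y).ne'
    rw [this]
    exact (hf.inv fun y => (hpos y).ne').smul hf'
  have hfd : fderiv ℝ f x = f x • (InnerProductSpace.toDual ℝ E) (l x) := by
    rw [← toDual_gradient, hfl]
    simp
  have h := ((hf x).hasFDerivAt.smul (hl' x).hasFDerivAt).fderiv
  have h2 : fderiv ℝ (∇ f) x = f x • fderiv ℝ l x + (fderiv ℝ f x).smulRight (l x) := by
    rw [hfl]; exact h
  rw [h2]
  refine (norm_add_le _ _).trans ?_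
  rw [norm_smul, ContinuousLinearMap.norm_smulRight_apply, hfd, norm_smul,
    Real.norm_of_nonneg (hpos x).le, LinearIsometryEquiv.norm_map]
  exact le_of_eq (by ring)

/-- The quadratic bound for a function with an `L`-Lipschitz gradient. -/
theorem abs_sub_sub_inner_gradient_le {f : E → ℝ} {L : ℝ} (hf : Differentiable ℝ f)
    (hL : ∀ x y, ‖(∇ f) y - (∇ f) x‖ ≤ L * ‖y - x‖) (x y : E) :
    |f y - f x - inner ℝ ((∇ f) x) (y - x)| ≤ L / 2 * ‖y - x‖ ^ 2 := by
  set v := y - x with hv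
  let φ : ℝ → ℝ := fun t => f (x + t • v) - f x - t * inner ℝ ((∇ f) x) v
  have hφ : ∀ t, HasDerivAt φ (inner ℝ ((∇ f) (x + t • v) - (∇ f) x) v) t := by
    intro t
    have h1 : HasDerivAt (fun t : ℝ => x + t • v) v t := by
      simpa using ((hasDerivAt_id t).smul_const v).const_add x
    have h2 := (hf (x + t • v)).hasFDerivAt.comp_hasDerivAt t h1
    have h3 := (h2.sub_const (f x)).sub ((hasDerivAt_id t).mul_const (inner ℝ ((∇ f) x) v))
    refine h3.congr_deriv ?_
    simp only [inner_sub_left, inner_gradient_left, one_mul]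
  have hB : ∀ t : ℝ, HasDerivAt (fun t : ℝ => L / 2 * ‖v‖ ^ 2 * t ^ 2) (L * ‖v‖ ^ 2 * t) t := by
    intro t
    refine ((hasDerivAt_pow 2 t).const_mul (L / 2 * ‖v‖ ^ 2)).congr_deriv ?_
    norm_num; ring
  have := image_norm_le_of_norm_deriv_right_le_deriv_boundary (a := 0) (b := 1)
    (f := φ) (f' := fun t => inner ℝ ((∇ f) (x + t • v) - (∇ f) x) v)
    (B := fun t : ℝ => L / 2 * ‖v‖ ^ 2 * t ^ 2) (B' := fun t => L * ‖v‖ ^ 2 * t)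
    (fun t _ => (hφ t).continuousAt.continuousWithinAt)
    (fun t _ => (hφ t).hasDerivWithinAt) (by simp [φ]) hB (fun t ht => by
      refine (norm_inner_le_norm _ _).trans ?_
      have h := hL x (x + t • v)
      rw [add_sub_cancel_left, norm_smul, Real.norm_of_nonneg ht.1] at h
      calc _ ≤ (L * (t * ‖v‖)) * ‖v‖ := by gcongr
        _ = _ := by ring) (x := 1) (by simp)
  simpa [φ, hv] using this

/-- The fundamental theorem of calculus as an inequality in `[0, ∞]`: no integrability of the
derivative is needed. -/
theorem enorm_sub_le_lintegral_enorm_deriv {F : Type*} [NormedAddCommGroup F] [NormedSpace ℝ F]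
    [CompleteSpace F] {φ φ' : ℝ → F} (h : ∀ t, HasDerivAt φ (φ' t) t) :
    ‖φ 1 - φ 0‖ₑ ≤ ∫⁻ t in Set.Ioc (0 : ℝ) 1, ‖φ' t‖ₑ := by
  by_cases hfin : ∫⁻ t in Set.Ioc (0 : ℝ) 1, ‖φ' t‖ₑ = ∞
  · simp [hfin]
  have hφ' : φ' = deriv φ := funext fun t => (h t).deriv.symm
  have hint : IntervalIntegrable φ' volume 0 1 := by
    rw [intervalIntegrable_iff_integrableOn_Ioc_of_le zero_le_one]
    refine ⟨?_, lt_top_iff_ne_top.2 hfin⟩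
    rw [hφ']
    exact aestronglyMeasurable_deriv _ _
  rw [← intervalIntegral.integral_eq_sub_of_hasDerivAt (fun t _ => h t) hint,
    intervalIntegral.integral_of_le zero_le_one]
  exact enorm_integral_le_lintegral_enorm _

variable {Ω : Type*} [MeasurableSpace Ω]

theorem measurable_gradient_of_measurable [FiniteDimensional ℝ E] [MeasurableSpace E] [BorelSpace E]
    {f : E → Ω → ℝ} (hf : ∀ x, Measurable (f x)) {x : E}
    (hd : ∀ ω, DifferentiableAt ℝ (fun y => f y ω) x) :
    Measurable fun ω => (∇ fun y => f y ω) x :=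
  (InnerProductSpace.toDual ℝ E).symm.continuous.measurable.comp
    (measurable_fderiv_of_measurable hf hd)

end Calculus

/-! ### Smooth families of densities -/

theorem norm_integral_smul_le_of_lintegral_enorm_le {Ω F : Type*} [MeasurableSpace Ω]
    {ν : Measure Ω} [NormedAddCommGroup F] [NormedSpace ℝ F] {f : Ω → ℝ} {g : Ω → F} {C K : ℝ}
    (hC : 0 ≤ C) (hK : 0 ≤ K) (hf : ∀ ω, |f ω| ≤ C) (hg : ∫⁻ ω, ‖g ω‖ₑ ∂ν ≤ ENNReal.ofReal K) :
    ‖∫ ω, f ω • g ω ∂ν‖ ≤ C * K := by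
  rw [← ENNReal.ofReal_le_ofReal_iff (by positivity), ofReal_norm]
  calc ‖∫ ω, f ω • g ω ∂ν‖ₑ ≤ ∫⁻ ω, ‖f ω • g ω‖ₑ ∂ν := enorm_integral_le_lintegral_enorm _
    _ ≤ ∫⁻ ω, ENNReal.ofReal C * ‖g ω‖ₑ ∂ν := by
      refine lintegral_mono fun ω => ?_
      rw [enorm_smul]
      gcongr
      rw [Real.enorm_eq_ofReal_abs]
      exact ENNReal.ofReal_le_ofReal (hf ω)
    _ = ENNReal.ofReal C * ∫⁻ ω, ‖g ω‖ₑ ∂ν := lintegral_const_mul' _ _ ENNReal.ofReal_ne_top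
    _ ≤ ENNReal.ofReal C * ENNReal.ofReal K := by gcongr
    _ = ENNReal.ofReal (C * K) := (ENNReal.ofReal_mul hC).symm

/-- A family of positive probability densities `q_θ`, `θ ∈ ℝᵈ`, with respect to `ν`, twice
differentiable in the parameter, whose score `∇ log q_θ` has second moment at most `A` under `q_θ`,
and whose log-Hessian has first moment at most `B`, uniformly in `θ`. The moments are taken in `[0, ∞]`,
so the bounds `A` and `B` include integrability. -/
structure IsSmoothDensityFamily {d : ℕ} {Ω : Type*} [MeasurableSpace Ω] (ν : Measure Ω)
    (q : EuclideanSpace ℝ (Fin d) → Ω → ℝ) (A B : ℝ≥0) : Prop where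
  measurable : ∀ θ, Measurable (q θ)
  pos : ∀ θ ω, 0 < q θ ω
  twiceDifferentiable : ∀ ω, TwiceDifferentiable fun θ => q θ ω
  lintegral_eq_one : ∀ θ, ∫⁻ ω, ENNReal.ofReal (q θ ω) ∂ν = 1
  score_le : ∀ θ,
    ∫⁻ ω, ENNReal.ofReal (q θ ω) * ‖(∇ fun θ' => Real.log (q θ' ω)) θ‖ₑ ^ 2 ∂ν ≤ A
  hessian_le : ∀ θ,
    ∫⁻ ω, ENNReal.ofReal (q θ ω) * ‖hessian (fun θ' => Real.log (q θ' ω)) θ‖ₑ ∂ν ≤ B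

namespace IsSmoothDensityFamily

variable {d : ℕ} {Ω : Type*} [MeasurableSpace Ω] {ν : Measure Ω}
  {q : EuclideanSpace ℝ (Fin d) → Ω → ℝ} {A B : ℝ≥0}

theorem differentiable (h : IsSmoothDensityFamily ν q A B) (ω : Ω) :
    Differentiable ℝ fun θ => q θ ω := (h.twiceDifferentiable ω).1

theorem differentiable_gradient (h : IsSmoothDensityFamily ν q A B) (ω : Ω) :
    Differentiable ℝ (∇ fun θ => q θ ω) := (h.twiceDifferentiable ω).2

theorem differentiable_log (h : IsSmoothDensityFamily ν q A B) (ω : Ω) :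
    Differentiable ℝ fun θ => Real.log (q θ ω) :=
  fun θ => (h.differentiable ω θ).log (h.pos θ ω).ne'

theorem differentiable_score (h : IsSmoothDensityFamily ν q A B) (ω : Ω) :
    Differentiable ℝ (∇ fun θ => Real.log (q θ ω)) := by
  have : (∇ fun θ => Real.log (q θ ω)) = fun θ => (q θ ω)⁻¹ • (∇ fun θ => q θ ω) θ :=
    funext fun θ => gradient_fun_log (h.differentiable ω θ) (h.pos θ ω).ne'
  rw [this]
  exact ((h.differentiable ω).inv fun θ => (h.pos θ ω).ne').smul (h.differentiable_gradient ω)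

theorem measurable_gradient (h : IsSmoothDensityFamily ν q A B) (θ) :
    Measurable fun ω => (∇ fun θ' => q θ' ω) θ :=
  measurable_gradient_of_measurable h.measurable fun ω => h.differentiable ω θ

theorem measurable_score (h : IsSmoothDensityFamily ν q A B) (θ) :
    Measurable fun ω => (∇ fun θ' => Real.log (q θ' ω)) θ :=
  measurable_gradient_of_measurable (f := fun θ ω => Real.log (q θ ω))
    (fun θ => (h.measurable θ).log) fun ω => h.differentiable_log ω θ

theorem gradient_eq (h : IsSmoothDensityFamily ν q A B) (θ ω) :
    (∇ fun θ' => q θ' ω) θ = q θ ω • (∇ fun θ' => Real.log (q θ' ω)) θ :=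
  gradient_eq_smul_gradient_log (h.differentiable ω θ) (h.pos θ ω).ne'

theorem integrable (h : IsSmoothDensityFamily ν q A B) (θ) : Integrable (q θ) ν := by
  refine ⟨(h.measurable θ).aestronglyMeasurable, ?_⟩
  rw [hasFiniteIntegral_iff_ofReal (Eventually.of_forall fun ω => (h.pos θ ω).le),
    h.lintegral_eq_one]
  exact ENNReal.one_lt_top

theorem integral_eq_one (h : IsSmoothDensityFamily ν q A B) (θ) : ∫ ω, q θ ω ∂ν = 1 := by
  rw [integral_eq_lintegral_of_nonneg_ae (Eventually.of_forall fun ω => (h.pos θ ω).le)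
    (h.measurable θ).aestronglyMeasurable, h.lintegral_eq_one, ENNReal.toReal_one]

theorem lintegral_gradient_le (h : IsSmoothDensityFamily ν q A B) (θ) :
    ∫⁻ ω, ‖(∇ fun θ' => q θ' ω) θ‖ₑ ∂ν ≤ ENNReal.ofReal (1 + A) := by
  -- the first moment of the score is controlled by its second moment
  have hx : ∀ x : ℝ≥0∞, x ≤ 1 + x ^ 2 := fun x => by
    rcases le_total x 1 with hx | hx
    · exact hx.trans le_self_add
    · exact (le_self_pow₀ hx two_ne_zero).trans le_add_self
  calc ∫⁻ ω, ‖(∇ fun θ' => q θ' ω) θ‖ₑ ∂ν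
      ≤ ∫⁻ ω, ENNReal.ofReal (q θ ω) +
          ENNReal.ofReal (q θ ω) * ‖(∇ fun θ' => Real.log (q θ' ω)) θ‖ₑ ^ 2 ∂ν := by
        refine lintegral_mono fun ω => ?_
        rw [h.gradient_eq, enorm_smul, Real.enorm_of_nonneg (h.pos θ ω).le]
        nth_rw 2 [← mul_one (ENNReal.ofReal (q θ ω))]
        rw [← mul_add]
        gcongr
        exact hx _
    _ ≤ 1 + A := by
        rw [lintegral_add_left (h.measurable θ).ennreal_ofReal, h.lintegral_eq_one]
        gcongr
        exact h.score_le θ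
    _ = ENNReal.ofReal (1 + A) := by
        rw [ENNReal.ofReal_add zero_le_one A.coe_nonneg, ENNReal.ofReal_one,
          ENNReal.ofReal_coe_nnreal]

theorem integrable_gradient (h : IsSmoothDensityFamily ν q A B) (θ) :
    Integrable (fun ω => (∇ fun θ' => q θ' ω) θ) ν :=
  ⟨(h.measurable_gradient θ).aestronglyMeasurable,
    (h.lintegral_gradient_le θ).trans_lt ENNReal.ofReal_lt_top⟩

/-- The Hessians are bounded by `A + B` in `L¹(ν)`. -/
theorem lintegral_hessian_le (h : IsSmoothDensityFamily ν q A B) (θ) :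
    ∫⁻ ω, ‖hessian (fun θ' => q θ' ω) θ‖ₑ ∂ν ≤ A + B := by
  calc ∫⁻ ω, ‖hessian (fun θ' => q θ' ω) θ‖ₑ ∂ν
      ≤ ∫⁻ ω, ENNReal.ofReal (q θ ω) * ‖(∇ fun θ' => Real.log (q θ' ω)) θ‖ₑ ^ 2
        + ENNReal.ofReal (q θ ω) * ‖hessian (fun θ' => Real.log (q θ' ω)) θ‖ₑ ∂ν := by
        refine lintegral_mono fun ω => ?_
        have := norm_fderiv_gradient_le_of_log (h.differentiable ω) (h.differentiable_gradient ω)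
          (fun θ => h.pos θ ω) θ
        have h0 := (h.pos θ ω).le
        rw [← ofReal_norm, ← ofReal_norm, ← ofReal_norm,
          ← ENNReal.ofReal_pow (norm_nonneg _), ← ENNReal.ofReal_mul h0, ← ENNReal.ofReal_mul h0,
          ← ENNReal.ofReal_add (by positivity) (by positivity)]
        exact ENNReal.ofReal_le_ofReal this
    _ ≤ A + B := by
        have hm : Measurable fun ω =>
            ENNReal.ofReal (q θ ω) * ‖(∇ fun θ' => Real.log (q θ' ω)) θ‖ₑ ^ 2 :=
          (h.measurable θ).ennreal_ofReal.mul ((h.measurable_score θ).enorm.pow_const 2)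
        rw [lintegral_add_left hm]
        exact add_le_add (h.score_le θ) (h.hessian_le θ)

theorem measurable_uncurry_gradient_line (h : IsSmoothDensityFamily ν q A B) (θ v) (c : ℝ) :
    Measurable fun p : ℝ × Ω => (∇ fun θ' => q θ' p.2) (θ + (p.1 + c) • v) :=
  measurable_uncurry_of_continuous_of_measurable
    (u := fun (t : ℝ) ω => (∇ fun θ' => q θ' ω) (θ + (t + c) • v))
    (fun ω => (h.differentiable_gradient ω).continuous.comp (by fun_prop))
    fun t => h.measurable_gradient _

theorem hasDerivAt_gradient_line (h : IsSmoothDensityFamily ν q A B) (θ v ω) (t : ℝ) :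
    HasDerivAt (fun t : ℝ => (∇ fun θ' => q θ' ω) (θ + t • v))
      (hessian (fun θ' => q θ' ω) (θ + t • v) v) t := by
  have h1 : HasDerivAt (fun t : ℝ => θ + t • v) v t := by
    simpa using ((hasDerivAt_id t).smul_const v).const_add θ
  exact (h.differentiable_gradient ω _).hasFDerivAt.comp_hasDerivAt t h1

theorem measurable_uncurry_hessian_line (h : IsSmoothDensityFamily ν q A B) (θ v) :
    Measurable fun p : ℝ × Ω => hessian (fun θ' => q θ' p.2) (θ + p.1 • v) v := by
  refine measurable_of_tendsto_metrizable (f := fun (n : ℕ) (p : ℝ × Ω) =>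
    (((n : ℝ) + 1)⁻¹)⁻¹ • ((∇ fun θ' => q θ' p.2) (θ + (p.1 + ((n : ℝ) + 1)⁻¹) • v)
      - (∇ fun θ' => q θ' p.2) (θ + p.1 • v))) (fun n => ?_) (tendsto_pi_nhds.2 fun p => ?_)
  · have h0 : Measurable fun p : ℝ × Ω => (∇ fun θ' => q θ' p.2) (θ + p.1 • v) := by
      simpa using h.measurable_uncurry_gradient_line θ v 0
    exact ((h.measurable_uncurry_gradient_line θ v _).sub h0).const_smul (((n : ℝ) + 1)⁻¹)⁻¹
  · exact (h.hasDerivAt_gradient_line θ v p.2 p.1).tendsto_slope_zero.comp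
      tendsto_inv_natCast_add_one_nhdsNE_zero

/-- The gradient is Lipschitz as a map from parameters to `L¹(ν)`. Only Tonelli's theorem is used on
the segment from `θ` to `θ + v`: neither continuity nor domination of the Hessians is needed. -/
theorem lintegral_gradient_sub_le [SFinite ν] (h : IsSmoothDensityFamily ν q A B) (θ v) :
    ∫⁻ ω, ‖(∇ fun θ' => q θ' ω) (θ + v) - (∇ fun θ' => q θ' ω) θ‖ₑ ∂ν ≤ (A + B) * ‖v‖ₑ := by
  calc ∫⁻ ω, ‖(∇ fun θ' => q θ' ω) (θ + v) - (∇ fun θ' => q θ' ω) θ‖ₑ ∂ν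
      ≤ ∫⁻ ω, (∫⁻ t in Set.Ioc (0 : ℝ) 1, ‖hessian (fun θ' => q θ' ω) (θ + t • v) v‖ₑ) ∂ν := by
        refine lintegral_mono fun ω => ?_
        simpa using enorm_sub_le_lintegral_enorm_deriv (h.hasDerivAt_gradient_line θ v ω)
    _ = ∫⁻ t in Set.Ioc (0 : ℝ) 1, ∫⁻ ω, ‖hessian (fun θ' => q θ' ω) (θ + t • v) v‖ₑ ∂ν :=
        (lintegral_lintegral_swap (μ := volume.restrict (Set.Ioc (0 : ℝ) 1)) (ν := ν)
          (f := fun t ω => ‖hessian (fun θ' => q θ' ω) (θ + t • v) v‖ₑ)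
          (h.measurable_uncurry_hessian_line θ v).enorm.aemeasurable).symm
    _ ≤ ∫⁻ _ in Set.Ioc (0 : ℝ) 1, (A + B) * ‖v‖ₑ := by
        refine lintegral_mono fun t => ?_
        calc ∫⁻ ω, ‖hessian (fun θ' => q θ' ω) (θ + t • v) v‖ₑ ∂ν
            ≤ ∫⁻ ω, ‖hessian (fun θ' => q θ' ω) (θ + t • v)‖ₑ * ‖v‖ₑ ∂ν :=
              lintegral_mono fun ω => ContinuousLinearMap.le_opENorm _ _
          _ = (∫⁻ ω, ‖hessian (fun θ' => q θ' ω) (θ + t • v)‖ₑ ∂ν) * ‖v‖ₑ :=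
              lintegral_mul_const' _ _ enorm_ne_top
          _ ≤ _ := by gcongr; exact h.lintegral_hessian_le _
    _ = (A + B) * ‖v‖ₑ := by simp

/-- First-order Taylor expansion of `θ ↦ q_θ` in `L¹(ν)`. -/
theorem lintegral_remainder_le [SFinite ν] (h : IsSmoothDensityFamily ν q A B) (θ v) :
    ∫⁻ ω, ‖q (θ + v) ω - q θ ω - inner ℝ ((∇ fun θ' => q θ' ω) θ) v‖ₑ ∂ν
      ≤ (A + B) * ‖v‖ₑ ^ 2 := by
  calc ∫⁻ ω, ‖q (θ + v) ω - q θ ω - inner ℝ ((∇ fun θ' => q θ' ω) θ) v‖ₑ ∂ν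
      ≤ ∫⁻ ω, (∫⁻ t in Set.Ioc (0 : ℝ) 1,
          ‖inner ℝ ((∇ fun θ' => q θ' ω) (θ + t • v) - (∇ fun θ' => q θ' ω) θ) v‖ₑ) ∂ν := by
        refine lintegral_mono fun ω => ?_
        have hd : ∀ t : ℝ, HasDerivAt
            (fun t : ℝ => q (θ + t • v) ω - t * inner ℝ ((∇ fun θ' => q θ' ω) θ) v)
            (inner ℝ ((∇ fun θ' => q θ' ω) (θ + t • v) - (∇ fun θ' => q θ' ω) θ) v) t := by
          intro t
          have h1 : HasDerivAt (fun t : ℝ => θ + t • v) v t := by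
            simpa using ((hasDerivAt_id t).smul_const v).const_add θ
          have h2 := (h.differentiable ω (θ + t • v)).hasFDerivAt.comp_hasDerivAt t h1
          refine (h2.sub ((hasDerivAt_id t).mul_const
            (inner ℝ ((∇ fun θ' => q θ' ω) θ) v))).congr_deriv ?_
          simp only [inner_sub_left, inner_gradient_left, one_mul]
        have := enorm_sub_le_lintegral_enorm_deriv hd
        simp only [one_smul, one_mul, zero_smul, zero_mul, add_zero, sub_zero] at this
        rwa [sub_right_comm] at this
    _ = ∫⁻ t in Set.Ioc (0 : ℝ) 1, ∫⁻ ω,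
          ‖inner ℝ ((∇ fun θ' => q θ' ω) (θ + t • v) - (∇ fun θ' => q θ' ω) θ) v‖ₑ ∂ν := by
        refine (lintegral_lintegral_swap (μ := volume.restrict (Set.Ioc (0 : ℝ) 1)) (ν := ν)
          (f := fun t ω => ‖inner ℝ ((∇ fun θ' => q θ' ω) (θ + t • v)
            - (∇ fun θ' => q θ' ω) θ) v‖ₑ) (Measurable.aemeasurable ?_)).symm
        have h1 : Measurable fun p : ℝ × Ω => (∇ fun θ' => q θ' p.2) (θ + p.1 • v) := by
          simpa using h.measurable_uncurry_gradient_line θ v 0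
        exact ((h1.sub ((h.measurable_gradient θ).comp measurable_snd)).inner_const).enorm
    _ ≤ ∫⁻ _ in Set.Ioc (0 : ℝ) 1, (A + B) * ‖v‖ₑ ^ 2 := by
        refine setLIntegral_mono' measurableSet_Ioc fun t ht => ?_
        calc ∫⁻ ω, ‖inner ℝ ((∇ fun θ' => q θ' ω) (θ + t • v) - (∇ fun θ' => q θ' ω) θ) v‖ₑ ∂ν
            ≤ ∫⁻ ω, ‖(∇ fun θ' => q θ' ω) (θ + t • v) - (∇ fun θ' => q θ' ω) θ‖ₑ * ‖v‖ₑ ∂ν :=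
              lintegral_mono fun ω => by
                simp only [enorm]
                exact_mod_cast nnnorm_inner_le_nnnorm _ _
          _ = (∫⁻ ω, ‖(∇ fun θ' => q θ' ω) (θ + t • v) - (∇ fun θ' => q θ' ω) θ‖ₑ ∂ν) * ‖v‖ₑ :=
              lintegral_mul_const' _ _ enorm_ne_top
          _ ≤ (A + B) * ‖t • v‖ₑ * ‖v‖ₑ := by gcongr; exact h.lintegral_gradient_sub_le _ _
          _ ≤ (A + B) * ‖v‖ₑ * ‖v‖ₑ := by
              gcongr
              rw [enorm_smul, Real.enorm_of_nonneg ht.1.le]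
              exact mul_le_of_le_one_left' (by simpa using ht.2)
          _ = _ := by ring
    _ = (A + B) * ‖v‖ₑ ^ 2 := by simp

section Expectation

variable {f : Ω → ℝ} {C : ℝ}

theorem integrable_smul_gradient (h : IsSmoothDensityFamily ν q A B) (hf : Measurable f)
    (hfC : ∀ ω, |f ω| ≤ C) (θ) : Integrable (fun ω => f ω • (∇ fun θ' => q θ' ω) θ) ν :=
  (h.integrable_gradient θ).bdd_smul C hf.aestronglyMeasurable (Eventually.of_forall hfC)

theorem hasGradientAt_integral [SFinite ν] (h : IsSmoothDensityFamily ν q A B) (hf : Measurable f)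
    (hC : 0 ≤ C) (hfC : ∀ ω, |f ω| ≤ C) (θ) :
    HasGradientAt (fun θ' => ∫ ω, f ω * q θ' ω ∂ν)
      (∫ ω, f ω • (∇ fun θ' => q θ' ω) θ ∂ν) θ := by
  have hint : ∀ θ', Integrable (fun ω => f ω * q θ' ω) ν := fun θ' =>
    (h.integrable θ').bdd_mul hf.aestronglyMeasurable (Eventually.of_forall hfC)
  have hint' := h.integrable_smul_gradient hf hfC θ
  rw [hasGradientAt_iff_isLittleO_nhds_zero]
  have hb : ∀ v, ‖(∫ ω, f ω * q (θ + v) ω ∂ν) - (∫ ω, f ω * q θ ω ∂ν)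
      - inner ℝ (∫ ω, f ω • (∇ fun θ' => q θ' ω) θ ∂ν) v‖ ≤ C * ((A + B) * ‖v‖ ^ 2) := by
    intro v
    have e : (∫ ω, f ω * q (θ + v) ω ∂ν) - (∫ ω, f ω * q θ ω ∂ν)
        - inner ℝ (∫ ω, f ω • (∇ fun θ' => q θ' ω) θ ∂ν) v
        = ∫ ω, f ω • (q (θ + v) ω - q θ ω - inner ℝ ((∇ fun θ' => q θ' ω) θ) v) ∂ν := by
      rw [real_inner_comm, ← integral_inner hint' v, ← integral_sub (hint _) (hint _),
        ← integral_sub (f := fun ω => f ω * q (θ + v) ω - f ω * q θ ω)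
          ((hint _).sub (hint _)) (hint'.const_inner v)]
      congr 1
      ext ω
      rw [inner_smul_right, real_inner_comm v, smul_eq_mul]
      ring
    rw [e]
    refine norm_integral_smul_le_of_lintegral_enorm_le hC (by positivity) hfC ?_
    refine (h.lintegral_remainder_le θ v).trans (le_of_eq ?_)
    rw [ENNReal.ofReal_mul (by positivity), ENNReal.ofReal_add A.coe_nonneg B.coe_nonneg,
      ENNReal.ofReal_coe_nnreal, ENNReal.ofReal_coe_nnreal, ENNReal.ofReal_pow (norm_nonneg _),
      ofReal_norm]
  refine (Asymptotics.isBigO_of_le' (c := C * (A + B)) (g := fun v => ‖v‖ ^ 2) _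
    fun v => (hb v).trans (le_of_eq ?_)).trans_isLittleO ?_
  · rw [norm_pow, norm_norm]; ring
  · exact Asymptotics.isLittleO_norm_pow_id one_lt_two

theorem norm_integral_smul_gradient_le (h : IsSmoothDensityFamily ν q A B)
    (hC : 0 ≤ C) (hfC : ∀ ω, |f ω| ≤ C) (θ) :
    ‖∫ ω, f ω • (∇ fun θ' => q θ' ω) θ ∂ν‖ ≤ C * (1 + A) :=
  norm_integral_smul_le_of_lintegral_enorm_le hC (by positivity) hfC (h.lintegral_gradient_le θ)

theorem norm_integral_smul_gradient_sub_le [SFinite ν] (h : IsSmoothDensityFamily ν q A B)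
    (hf : Measurable f) (hC : 0 ≤ C) (hfC : ∀ ω, |f ω| ≤ C) (θ θ') :
    ‖(∫ ω, f ω • (∇ fun θ' => q θ' ω) θ' ∂ν) - ∫ ω, f ω • (∇ fun θ' => q θ' ω) θ ∂ν‖
      ≤ C * ((A + B) * ‖θ' - θ‖) := by
  rw [← integral_sub (h.integrable_smul_gradient hf hfC _) (h.integrable_smul_gradient hf hfC _)]
  simp_rw [← smul_sub]
  refine norm_integral_smul_le_of_lintegral_enorm_le hC (by positivity) hfC ?_
  have := h.lintegral_gradient_sub_le θ (θ' - θ)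
  rw [add_sub_cancel] at this
  refine this.trans (le_of_eq ?_)
  rw [ENNReal.ofReal_mul (by positivity), ENNReal.ofReal_add A.coe_nonneg B.coe_nonneg,
    ENNReal.ofReal_coe_nnreal, ENNReal.ofReal_coe_nnreal, ofReal_norm]

/-- The score is centred: differentiate `∫ q_θ dν = 1`. -/
theorem integral_gradient_eq_zero [SFinite ν] (h : IsSmoothDensityFamily ν q A B) (θ) :
    ∫ ω, (∇ fun θ' => q θ' ω) θ ∂ν = 0 := by
  have h1 := h.hasGradientAt_integral (f := fun _ => 1) measurable_const zero_le_one
    (fun _ => by simp) θ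
  simp only [one_mul, one_smul, h.integral_eq_one] at h1
  exact h1.unique (hasGradientAt_const θ (1 : ℝ))

end Expectation

end IsSmoothDensityFamily

/-! ### Two-stage sampling: orthogonality of scores -/

theorem lintegral_compProd_prod_const {Ω S A : Type*} [MeasurableSpace Ω] [MeasurableSpace S]
    [MeasurableSpace A] {ν : Measure Ω} [SFinite ν] {κ : Kernel Ω S} [IsSFiniteKernel κ]
    {μ : Measure A} [SFinite μ] {f : Ω × (S × A) → ℝ≥0∞} (hf : Measurable f) :
    ∫⁻ x, f x ∂(ν ⊗ₘ (κ ×ₖ Kernel.const Ω μ))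
      = ∫⁻ ω, ∫⁻ s, ∫⁻ a, f (ω, (s, a)) ∂μ ∂(κ ω) ∂ν := by
  rw [Measure.lintegral_compProd hf]
  refine lintegral_congr fun ω => ?_
  rw [Kernel.prod_apply, Kernel.const_apply, lintegral_prod _ (by fun_prop)]

namespace IsSmoothDensityFamily

variable {d : ℕ} {Ω : Type*} [MeasurableSpace Ω] {ν : Measure Ω}
  {q : EuclideanSpace ℝ (Fin d) → Ω → ℝ} {A B : ℝ≥0}

theorem measurable_hessian_log (h : IsSmoothDensityFamily ν q A B) (θ) :
    Measurable fun ω => hessian (fun θ' => Real.log (q θ' ω)) θ :=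
  measurable_fderiv_of_measurable (f := fun θ ω => (∇ fun θ' => Real.log (q θ' ω)) θ)
    h.measurable_score fun ω => h.differentiable_score ω θ

/-- Translating the score by `x` adds exactly `‖x‖²` to its second moment, because the score is
centred. -/
theorem lintegral_add_score_le [SFinite ν] (h : IsSmoothDensityFamily ν q A B) (θ x) :
    ∫⁻ ω, ENNReal.ofReal (q θ ω) * ‖x + (∇ fun θ' => Real.log (q θ' ω)) θ‖ₑ ^ 2 ∂ν
      ≤ ‖x‖ₑ ^ 2 + A := by
  set y := fun ω => (∇ fun θ' => Real.log (q θ' ω)) θ with hy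
  have hym : Measurable y := h.measurable_score θ
  have hconv : ∀ ω, ∀ z : EuclideanSpace ℝ (Fin d),
      ENNReal.ofReal (q θ ω) * ‖z‖ₑ ^ 2 = ENNReal.ofReal (q θ ω * ‖z‖ ^ 2) := fun ω z => by
    rw [ENNReal.ofReal_mul (h.pos θ ω).le, ENNReal.ofReal_pow (norm_nonneg _), ofReal_norm]
  have hsq : ∫⁻ ω, ENNReal.ofReal (q θ ω * ‖y ω‖ ^ 2) ∂ν ≤ A := by
    simpa only [hconv] using h.score_le θ
  have hnn : ∀ z : Ω → EuclideanSpace ℝ (Fin d), 0 ≤ᵐ[ν] fun ω => q θ ω * ‖z ω‖ ^ 2 :=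
    fun z => Eventually.of_forall fun ω => mul_nonneg (h.pos θ ω).le (sq_nonneg _)
  have hmeas : Measurable fun ω => q θ ω * ‖y ω‖ ^ 2 := (h.measurable θ).mul (hym.norm.pow_const 2)
  have hint : Integrable (fun ω => q θ ω * ‖y ω‖ ^ 2) ν := by
    refine ⟨hmeas.aestronglyMeasurable, ?_⟩
    rw [hasFiniteIntegral_iff_ofReal (hnn y)]
    exact hsq.trans_lt ENNReal.coe_lt_top
  have hle : ∫ ω, q θ ω * ‖y ω‖ ^ 2 ∂ν ≤ A := by
    rw [integral_eq_lintegral_of_nonneg_ae (hnn y) hmeas.aestronglyMeasurable]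
    exact ENNReal.toReal_mono ENNReal.coe_ne_top hsq
  have hg := h.integrable_gradient θ
  have hexp : ∀ ω, q θ ω * ‖x + y ω‖ ^ 2 = (q θ ω * ‖x‖ ^ 2
      + 2 * inner ℝ x ((∇ fun θ' => q θ' ω) θ)) + q θ ω * ‖y ω‖ ^ 2 := fun ω => by
    rw [norm_add_sq_real, h.gradient_eq, inner_smul_right]
    ring
  have hint1 : Integrable (fun ω => q θ ω * ‖x‖ ^ 2
      + 2 * inner ℝ x ((∇ fun θ' => q θ' ω) θ)) ν :=
    ((h.integrable θ).mul_const _).add ((hg.const_inner x).const_mul 2)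
  have hint2 : Integrable (fun ω => q θ ω * ‖x + y ω‖ ^ 2) ν := by
    simp only [hexp]
    exact hint1.add hint
  have key : ∫ ω, q θ ω * ‖x + y ω‖ ^ 2 ∂ν ≤ ‖x‖ ^ 2 + A := by
    simp only [hexp]
    rw [integral_add hint1 hint,
      integral_add ((h.integrable θ).mul_const _) ((hg.const_inner x).const_mul 2),
      integral_mul_const, integral_const_mul, integral_inner hg, h.integral_gradient_eq_zero,
      h.integral_eq_one, inner_zero_right]
    linarith
  calc ∫⁻ ω, ENNReal.ofReal (q θ ω) * ‖x + y ω‖ₑ ^ 2 ∂ν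
      = ENNReal.ofReal (∫ ω, q θ ω * ‖x + y ω‖ ^ 2 ∂ν) := by
        rw [ofReal_integral_eq_lintegral_ofReal hint2 (hnn fun ω => x + y ω)]
        simp only [hconv]
    _ ≤ ENNReal.ofReal (‖x‖ ^ 2 + A) := ENNReal.ofReal_le_ofReal key
    _ = ‖x‖ₑ ^ 2 + A := by
        rw [ENNReal.ofReal_add (by positivity) A.coe_nonneg, ENNReal.ofReal_coe_nnreal,
          ENNReal.ofReal_pow (norm_nonneg _), ofReal_norm]

theorem lintegral_add_hessian_log_le (h : IsSmoothDensityFamily ν q A B) (θ)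
    (T : EuclideanSpace ℝ (Fin d) →L[ℝ] EuclideanSpace ℝ (Fin d)) :
    ∫⁻ ω, ENNReal.ofReal (q θ ω) * ‖T + hessian (fun θ' => Real.log (q θ' ω)) θ‖ₑ ∂ν
      ≤ ‖T‖ₑ + B := by
  calc _ ≤ ∫⁻ ω, ENNReal.ofReal (q θ ω) * ‖T‖ₑ
        + ENNReal.ofReal (q θ ω) * ‖hessian (fun θ' => Real.log (q θ' ω)) θ‖ₑ ∂ν := by
        refine lintegral_mono fun ω => ?_
        rw [← mul_add]
        gcongr
        exact enorm_add_le T (hessian (fun θ' => Real.log (q θ' ω)) θ)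
    _ ≤ _ := by
        have hm : Measurable fun ω => ENNReal.ofReal (q θ ω) := (h.measurable θ).ennreal_ofReal
        rw [lintegral_add_left (hm.mul_const _), lintegral_mul_const _ hm, h.lintegral_eq_one,
          one_mul]
        gcongr
        exact h.hessian_le θ

/-- Draw `ω` from `q_θ`, then `s` from a kernel `κ(ω, ·)` that does not depend on `θ`, then `a` from
the density `p_θ(s, ·)`. The scores of the two stages are orthogonal, so that their second
moments add up. -/
theorem compProd [SFinite ν] (h : IsSmoothDensityFamily ν q A B) {S α : Type*} [MeasurableSpace S]
    [MeasurableSpace α] (κ : Kernel Ω S) [IsMarkovKernel κ] {μ : Measure α} [SFinite μ]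
    {p : EuclideanSpace ℝ (Fin d) → S → α → ℝ} {A' B' : ℝ≥0}
    (hpm : ∀ θ, Measurable (Function.uncurry (p θ)))
    (hp : ∀ s, IsSmoothDensityFamily μ (fun θ => p θ s) A' B') :
    IsSmoothDensityFamily (ν ⊗ₘ (κ ×ₖ Kernel.const Ω μ))
      (fun θ x => q θ x.1 * p θ x.2.1 x.2.2) (A + A') (B + B') := by
  have hqm : ∀ θ, Measurable fun x : Ω × (S × α) => q θ x.1 :=
    fun θ => (h.measurable θ).comp measurable_fst
  have hpm' : ∀ θ, Measurable fun x : Ω × (S × α) => p θ x.2.1 x.2.2 :=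
    fun θ => (hpm θ).comp measurable_snd
  have hqpm : ∀ θ, Measurable fun x : Ω × (S × α) =>
      ENNReal.ofReal (q θ x.1 * p θ x.2.1 x.2.2) :=
    fun θ => ((hqm θ).mul (hpm' θ)).ennreal_ofReal
  have hscore : ∀ x : Ω × (S × α), (∇ fun θ => Real.log (q θ x.1 * p θ x.2.1 x.2.2))
      = fun θ => (∇ fun θ => Real.log (q θ x.1)) θ + (∇ fun θ => Real.log (p θ x.2.1 x.2.2)) θ := by
    intro x
    have : (fun θ => Real.log (q θ x.1 * p θ x.2.1 x.2.2))
        = fun θ => Real.log (q θ x.1) + Real.log (p θ x.2.1 x.2.2) :=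
      funext fun θ => Real.log_mul (h.pos θ _).ne' ((hp _).pos θ _).ne'
    rw [this]
    exact funext fun θ =>
      gradient_fun_add (h.differentiable_log _ θ) ((hp _).differentiable_log _ θ)
  have hhess : ∀ (x : Ω × (S × α)) θ, hessian (fun θ => Real.log (q θ x.1 * p θ x.2.1 x.2.2)) θ
      = hessian (fun θ => Real.log (q θ x.1)) θ
        + hessian (fun θ => Real.log (p θ x.2.1 x.2.2)) θ := by
    intro x θ
    rw [hessian, hscore]
    exact fderiv_fun_add (h.differentiable_score _ θ) ((hp _).differentiable_score _ θ)
  have hsm : ∀ θ, Measurable fun x : Ω × (S × α) => (∇ fun θ => Real.log (p θ x.2.1 x.2.2)) θ :=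
    fun θ => measurable_gradient_of_measurable
      (f := fun θ (x : Ω × (S × α)) => Real.log (p θ x.2.1 x.2.2))
      (fun θ => (hpm' θ).log) fun x => (hp _).differentiable_log _ θ
  have hhm : ∀ θ, Measurable fun x : Ω × (S × α) =>
      hessian (fun θ => Real.log (p θ x.2.1 x.2.2)) θ :=
    fun θ => measurable_fderiv_of_measurable
      (f := fun θ (x : Ω × (S × α)) => (∇ fun θ => Real.log (p θ x.2.1 x.2.2)) θ) hsm
      fun x => (hp _).differentiable_score _ θ
  refine ⟨fun θ => (hqm θ).mul (hpm' θ), fun θ x => mul_pos (h.pos θ _) ((hp _).pos θ _),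
    fun x => ⟨(h.differentiable _).mul ((hp _).differentiable _), ?_⟩, fun θ => ?_, fun θ => ?_,
    fun θ => ?_⟩
  · have : (∇ fun θ => q θ x.1 * p θ x.2.1 x.2.2) = fun θ =>
        q θ x.1 • (∇ fun θ => p θ x.2.1 x.2.2) θ + p θ x.2.1 x.2.2 • (∇ fun θ => q θ x.1) θ :=
      funext fun θ => gradient_fun_mul (h.differentiable _ θ) ((hp _).differentiable _ θ)
    rw [this]
    exact ((h.differentiable _).smul ((hp _).differentiable_gradient _)).add
      (((hp _).differentiable _).smul (h.differentiable_gradient _))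
  · rw [lintegral_compProd_prod_const (hqpm θ)]
    simp only [ENNReal.ofReal_mul (h.pos θ _).le,
      lintegral_const_mul' _ _ ENNReal.ofReal_ne_top, (hp _).lintegral_eq_one, lintegral_const,
      measure_univ, mul_one, h.lintegral_eq_one]
  · simp only [hscore]
    have hm : Measurable fun x : Ω × (S × α) => ENNReal.ofReal (q θ x.1 * p θ x.2.1 x.2.2)
        * ‖(∇ fun θ => Real.log (q θ x.1)) θ + (∇ fun θ => Real.log (p θ x.2.1 x.2.2)) θ‖ₑ ^ 2 :=
      (hqpm θ).mul
        ((((h.measurable_score θ).comp measurable_fst).add (hsm θ)).enorm.pow_const 2)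
    rw [lintegral_compProd_prod_const hm]
    calc _ ≤ ∫⁻ ω, ENNReal.ofReal (q θ ω) * ‖(∇ fun θ => Real.log (q θ ω)) θ‖ₑ ^ 2
          + ENNReal.ofReal (q θ ω) * A' ∂ν := by
          refine lintegral_mono fun ω => ?_
          rw [← mul_add]
          simp only [ENNReal.ofReal_mul (h.pos θ _).le, mul_assoc,
            lintegral_const_mul' _ _ ENNReal.ofReal_ne_top]
          gcongr
          refine (lintegral_mono fun s => (hp s).lintegral_add_score_le θ _).trans ?_
          simp
      _ ≤ (A + A' : ℝ≥0) := by
          have hm := (h.measurable θ).ennreal_ofReal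
          rw [lintegral_add_right _ (hm.mul_const _), lintegral_mul_const _ hm,
            h.lintegral_eq_one, one_mul, ENNReal.coe_add]
          gcongr
          exact h.score_le θ
  · simp only [hhess]
    have hm : Measurable fun x : Ω × (S × α) => ENNReal.ofReal (q θ x.1 * p θ x.2.1 x.2.2)
        * ‖hessian (fun θ => Real.log (q θ x.1)) θ
          + hessian (fun θ => Real.log (p θ x.2.1 x.2.2)) θ‖ₑ :=
      (hqpm θ).mul (((h.measurable_hessian_log θ).comp measurable_fst).add (hhm θ)).enorm
    rw [lintegral_compProd_prod_const hm]
    calc _ ≤ ∫⁻ ω, ENNReal.ofReal (q θ ω) * ‖hessian (fun θ => Real.log (q θ ω)) θ‖ₑ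
          + ENNReal.ofReal (q θ ω) * B' ∂ν := by
          refine lintegral_mono fun ω => ?_
          rw [← mul_add]
          simp only [ENNReal.ofReal_mul (h.pos θ _).le, mul_assoc,
            lintegral_const_mul' _ _ ENNReal.ofReal_ne_top]
          gcongr
          refine (lintegral_mono fun s => (hp s).lintegral_add_hessian_log_le θ _).trans ?_
          simp
      _ ≤ (B + B' : ℝ≥0) := by
          have hm := (h.measurable θ).ennreal_ofReal
          rw [lintegral_add_right _ (hm.mul_const _), lintegral_mul_const _ hm,
            h.lintegral_eq_one, one_mul, ENNReal.coe_add]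
          gcongr
          exact h.hessian_le θ

end IsSmoothDensityFamily

/-- The measures `m_θ` are the laws of a fixed random variable `X` under a family of smooth
densities `q_θ`. The `m_θ` themselves need not have densities with respect to a common measure. The sample space `Ω`
is taken in the universe of `𝓧`, which suffices for histories of the chain. -/
def IsSmoothMarginal.{w} {d : ℕ} {𝓧 : Type w} [MeasurableSpace 𝓧]
    (m : EuclideanSpace ℝ (Fin d) → Measure 𝓧) (A B : ℝ≥0) : Prop :=
  ∃ (Ω : Type w) (_ : MeasurableSpace Ω) (ν : Measure Ω) (_ : SFinite ν)
    (q : EuclideanSpace ℝ (Fin d) → Ω → ℝ) (X : Ω → 𝓧), Measurable X ∧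
    IsSmoothDensityFamily ν q A B ∧
    ∀ θ, m θ = (ν.withDensity fun ω => ENNReal.ofReal (q θ ω)).map X

/-! ### Marginal laws of the state-action chain -/

theorem lintegral_withDensity_ofReal {Ω : Type*} [MeasurableSpace Ω] {ν : Measure Ω} {f : Ω → ℝ}
    (hf : Measurable f) (g : Ω → ℝ≥0∞) :
    ∫⁻ x, g x ∂(ν.withDensity fun x => ENNReal.ofReal (f x))
      = ∫⁻ x, ENNReal.ofReal (f x) * g x ∂ν :=
  lintegral_withDensity_eq_lintegral_mul_non_measurable _ hf.ennreal_ofReal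
    (Eventually.of_forall fun _ => ENNReal.ofReal_lt_top) _

section Marginal

universe u v

variable {d : ℕ} {A B : ℝ≥0}

theorem IsSmoothMarginal.exists_integral_eq {𝓧 : Type u} [MeasurableSpace 𝓧]
    {m : EuclideanSpace ℝ (Fin d) → Measure 𝓧} (hm : IsSmoothMarginal m A B) {f : 𝓧 → ℝ}
    (hf : Measurable f) :
    ∃ (Ω : Type u) (_ : MeasurableSpace Ω) (ν : Measure Ω) (_ : SFinite ν)
    (q : EuclideanSpace ℝ (Fin d) → Ω → ℝ) (X : Ω → 𝓧), Measurable X ∧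
    IsSmoothDensityFamily ν q A B ∧ ∀ θ, ∫ x, f x ∂(m θ) = ∫ ω, f (X ω) * q θ ω ∂ν := by
  obtain ⟨Ω, mΩ, ν, hν, q, X, hX, h, e⟩ := hm
  refine ⟨Ω, mΩ, ν, hν, q, X, hX, h, fun θ => ?_⟩
  rw [e, integral_map hX.aemeasurable hf.aestronglyMeasurable,
    integral_withDensity_eq_integral_toReal_smul (h.measurable θ).ennreal_ofReal
      (Eventually.of_forall fun _ => ENNReal.ofReal_lt_top)]
  refine integral_congr_ae (Eventually.of_forall fun ω => ?_)
  simp only [ENNReal.toReal_ofReal (h.pos θ ω).le, smul_eq_mul, mul_comm]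

/-- Expectations of functions bounded by `C` inherit smoothness with the constant `C (A + B)`. -/
theorem IsSmoothMarginal.differentiable_integral {𝓧 : Type u} [MeasurableSpace 𝓧]
    {m : EuclideanSpace ℝ (Fin d) → Measure 𝓧} (hm : IsSmoothMarginal m A B) {f : 𝓧 → ℝ} {C : ℝ}
    (hf : Measurable f) (hC : 0 ≤ C) (hfC : ∀ x, |f x| ≤ C) :
    Differentiable ℝ (fun θ => ∫ x, f x ∂(m θ)) ∧
    (∀ θ, ‖(∇ fun θ => ∫ x, f x ∂(m θ)) θ‖ ≤ C * (1 + A)) ∧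
    ∀ θ θ', ‖(∇ fun θ => ∫ x, f x ∂(m θ)) θ' - (∇ fun θ => ∫ x, f x ∂(m θ)) θ‖
      ≤ C * ((A + B) * ‖θ' - θ‖) := by
  obtain ⟨Ω, mΩ, ν, hν, q, X, hX, h, e⟩ := hm.exists_integral_eq hf
  have hfX : ∀ ω, |f (X ω)| ≤ C := fun ω => hfC _
  have hg : ∀ θ, HasGradientAt (fun θ' => ∫ ω, f (X ω) * q θ' ω ∂ν)
      (∫ ω, f (X ω) • (∇ fun θ' => q θ' ω) θ ∂ν) θ :=
    h.hasGradientAt_integral (hf.comp hX) hC hfX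
  simp only [e]
  refine ⟨fun θ => (hg θ).differentiableAt, fun θ => ?_, fun θ θ' => ?_⟩
  · rw [(hg θ).gradient]
    exact h.norm_integral_smul_gradient_le hC hfX θ
  · rw [(hg θ).gradient, (hg θ').gradient]
    exact h.norm_integral_smul_gradient_sub_le (hf.comp hX) hC hfX θ θ'

end Marginal

section Step

universe u v

variable {S : Type u} {A : Type v} [MeasurableSpace S] [MeasurableSpace A] {μ : Measure A}
  [SigmaFinite μ] {d : ℕ} {π : EuclideanSpace ℝ (Fin d) → Policy S μ} {G F : ℝ}

theorem IsExpectedLipschitzSmooth.isSmoothDensityFamily (hELS : IsExpectedLipschitzSmooth π G F)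
    (hπ : IsRegularFamily π) (s : S) :
    IsSmoothDensityFamily μ (fun θ a => (π θ).dens s a) (G ^ 2).toNNReal F.toNNReal := by
  have hm : ∀ θ, Measurable fun a => (π θ).dens s a :=
    fun θ => (π θ).measurable_dens.comp measurable_prodMk_left
  refine ⟨hm, fun θ a => hπ.dens_pos θ s a, fun a => hπ.twiceDifferentiable s a,
    fun θ => (π θ).lintegral_dens s, fun θ => ?_, fun θ => ?_⟩
  · have := hELS.gradient_le θ s
    rwa [Policy.kernel_apply, lintegral_withDensity_ofReal (hm θ)] at this
  · have := hELS.hessian_le θ s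
    rwa [Policy.kernel_apply, lintegral_withDensity_ofReal (hm θ)] at this

/-- The law of `(s, a)`, `a ∼ π(· | s)`, given `s`. -/
def Policy.draw (π : Policy S μ) : Kernel S (S × A) := Kernel.id ×ₖ π.kernel

instance Policy.isMarkovKernel_draw (π : Policy S μ) : IsMarkovKernel π.draw := by
  unfold Policy.draw; infer_instance

theorem Policy.lintegral_draw (π : Policy S μ) (s : S) {g : S × A → ℝ≥0∞} (hg : Measurable g) :
    ∫⁻ x, g x ∂(π.draw s) = ∫⁻ a, ENNReal.ofReal (π.dens s a) * g (s, a) ∂μ := by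
  have hm : Measurable fun a => π.dens s a := π.measurable_dens.comp measurable_prodMk_left
  rw [Policy.draw, Kernel.lintegral_id_prod hg, Policy.kernel_apply,
    lintegral_withDensity_ofReal hm]

/-- One more transition of the chain: move by a kernel that does not depend on `θ`, then draw an
action. -/
theorem IsSmoothMarginal.draw_comp {𝓧 : Type max u v} [MeasurableSpace 𝓧]
    {m : EuclideanSpace ℝ (Fin d) → Measure 𝓧} {A₀ B₀ : ℝ≥0} (hm : IsSmoothMarginal m A₀ B₀)
    (P : Kernel 𝓧 S) [IsMarkovKernel P]
    (hELS : IsExpectedLipschitzSmooth π G F) (hπ : IsRegularFamily π) :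
    IsSmoothMarginal (fun θ => (π θ).draw ∘ₘ (P ∘ₘ m θ))
      (A₀ + (G ^ 2).toNNReal) (B₀ + F.toNNReal) := by
  obtain ⟨Ω, mΩ, ν, hν, q, X, hX, h, e⟩ := hm
  have h' := h.compProd (P.comap X hX) (fun θ => (π θ).measurable_dens)
    (fun s => hELS.isSmoothDensityFamily hπ s)
  refine ⟨Ω × (S × A), inferInstance, ν ⊗ₘ (P.comap X hX ×ₖ Kernel.const Ω μ), inferInstance,
    _, Prod.snd, measurable_snd, h', fun θ => ?_⟩
  refine Measure.ext_of_lintegral _ fun g hg => ?_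
  have hgq : Measurable fun x : Ω × (S × A) =>
      ENNReal.ofReal (q θ x.1 * (π θ).dens x.2.1 x.2.2) * g x.2 :=
    (h'.measurable θ).ennreal_ofReal.mul (hg.comp measurable_snd)
  have hgd : Measurable fun s => ∫⁻ x, g x ∂((π θ).draw s) := hg.lintegral_kernel
  have hgP : Measurable fun x => ∫⁻ s, ∫⁻ x, g x ∂((π θ).draw s) ∂(P x) := hgd.lintegral_kernel
  rw [Measure.lintegral_bind (Kernel.aemeasurable _) hg.aemeasurable,
    Measure.lintegral_bind (Kernel.aemeasurable _) hgd.aemeasurable, e,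
    lintegral_map hgP hX, lintegral_withDensity_ofReal (h.measurable θ),
    lintegral_map hg measurable_snd, lintegral_withDensity_ofReal (h'.measurable θ),
    lintegral_compProd_prod_const hgq]
  refine lintegral_congr fun ω => ?_
  simp only [ENNReal.ofReal_mul (h.pos θ _).le, mul_assoc,
    lintegral_const_mul' _ _ ENNReal.ofReal_ne_top, Kernel.comap_apply,
    Policy.lintegral_draw _ _ hg]

theorem isSmoothMarginal_draw (ρ : Measure S) [IsProbabilityMeasure ρ]
    (hELS : IsExpectedLipschitzSmooth π G F) (hπ : IsRegularFamily π) :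
    IsSmoothMarginal (fun θ => (π θ).draw ∘ₘ ρ) (G ^ 2).toNNReal F.toNNReal := by
  -- a deterministic start is a one-point model, without any dependence on `θ`
  have h0 : IsSmoothMarginal (d := d) (fun _ => Measure.dirac (PUnit.unit.{max u v + 1})) 0 0 := by
    refine ⟨PUnit, inferInstance, Measure.dirac PUnit.unit, inferInstance, fun _ _ => 1, id,
      measurable_id, ⟨fun _ => measurable_const, fun _ _ => one_pos, fun _ => ⟨?_, ?_⟩, ?_, ?_, ?_⟩,
      ?_⟩
    · fun_prop
    · rw [gradient_fun_const']; fun_prop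
    · simp
    · simp
    · have h0 : hessian (fun _ : EuclideanSpace ℝ (Fin d) => (0 : ℝ)) = 0 := by
        funext θ
        simp [hessian, gradient_fun_const']
      simp only [Real.log_one, h0, Pi.zero_apply]
      rw [← ofReal_norm, norm_zero]
      simp
    · simp
  simpa using h0.draw_comp (Kernel.const _ ρ) hELS hπ

variable (M : MDP S A)

theorem MDP.step_eq (π : Policy S μ) : M.step π = π.draw ∘ₖ M.P := by
  ext x : 1
  refine Measure.ext_of_lintegral _ fun g hg => ?_
  rw [MDP.step, Kernel.lintegral_compProd _ _ _ hg, Kernel.lintegral_comp _ _ _ hg]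
  refine lintegral_congr fun s => ?_
  rw [Policy.draw, Kernel.lintegral_id_prod hg, Kernel.prodMkLeft_apply]

/-- The law of `(s_t, a_t)` given `s₀`. -/
def MDP.marginal (π : Policy S μ) : ℕ → Kernel S (S × A)
  | 0 => π.draw
  | t + 1 => M.step π ∘ₖ MDP.marginal π t

instance MDP.isMarkovKernel_marginal (π : Policy S μ) (t : ℕ) :
    IsMarkovKernel (M.marginal π t) := by
  induction t with
  | zero => unfold MDP.marginal; infer_instance
  | succ t ih => unfold MDP.marginal; infer_instance

/-- The chain splits after its first transition instead of before its last one. -/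
theorem MDP.marginal_succ' (π : Policy S μ) (t : ℕ) :
    M.marginal π (t + 1) = M.marginal π t ∘ₖ (M.P ∘ₖ π.draw) := by
  induction t with
  | zero => simp only [MDP.marginal, M.step_eq, Kernel.comp_assoc]
  | succ t ih =>
    calc M.marginal π (t + 1 + 1) = M.step π ∘ₖ M.marginal π (t + 1) := rfl
      _ = (M.step π ∘ₖ M.marginal π t) ∘ₖ (M.P ∘ₖ π.draw) := by rw [ih, Kernel.comp_assoc]

/-- Up to time `t`, there are `t + 1` draws of an action, whose orthogonal scores contribute `G²` each
to the second moment. -/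
theorem isSmoothMarginal_marginal (ρ : Measure S) [IsProbabilityMeasure ρ]
    (hELS : IsExpectedLipschitzSmooth π G F) (hπ : IsRegularFamily π) (t : ℕ) :
    IsSmoothMarginal (fun θ => M.marginal (π θ) t ∘ₘ ρ)
      ((t + 1) * (G ^ 2).toNNReal) ((t + 1) * F.toNNReal) := by
  induction t with
  | zero => simpa [MDP.marginal] using isSmoothMarginal_draw ρ hELS hπ
  | succ t ih =>
    have := ih.draw_comp M.P hELS hπ
    convert this using 1
    · funext θ
      rw [MDP.marginal, M.step_eq, Measure.comp_assoc, Measure.comp_assoc, Kernel.comp_assoc]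
    · push_cast; ring
    · push_cast; ring

/-- The expected reward at time `t` when the initial state has law `ρ`. -/
def MDP.rewardAt (π : Policy S μ) (t : ℕ) (ρ : Measure S) : ℝ :=
  ∫ x, M.R x.1 x.2 ∂(M.marginal π t ∘ₘ ρ)

theorem MDP.measurable_R' : Measurable fun x : S × A => M.R x.1 x.2 := M.measurable_R

theorem MDP.integrable_R (m : Measure (S × A)) [IsFiniteMeasure m] :
    Integrable (fun x : S × A => M.R x.1 x.2) m :=
  Integrable.of_bound M.measurable_R'.aestronglyMeasurable M.Rmax
    (Eventually.of_forall fun x => M.abs_R_le x.1 x.2)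

theorem MDP.abs_rewardAt_le (π : Policy S μ) (t : ℕ) (ρ : Measure S) [IsProbabilityMeasure ρ] :
    |M.rewardAt π t ρ| ≤ M.Rmax := by
  have := norm_integral_le_of_norm_le_const (μ := M.marginal π t ∘ₘ ρ)
    (f := fun x => M.R x.1 x.2) (Eventually.of_forall fun x => M.abs_R_le x.1 x.2)
  simpa [MDP.rewardAt] using this

/-- The law of `(s_t, a_t)` under the law of the trajectory. -/
theorem MDP.map_trajectoryLaw (π : Policy S μ) (t : ℕ) :
    (M.trajectoryLaw π).map (fun τ => τ t) = M.marginal π t ∘ₘ M.ρ := by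
  induction t with
  | zero =>
    have h : (M.trajectoryLaw π).map (Preorder.frestrictLe 0)
        = (M.ρ ⊗ₘ π.kernel).map (MeasurableEquiv.piUnique _).symm := by
      rw [MDP.trajectoryLaw, Kernel.trajMeasure, Measure.map_comp _ _ (by fun_prop),
        Kernel.traj_map_frestrictLe, Kernel.partialTraj_self, Measure.id_comp]
    have h2 : (fun τ : ℕ → S × A => τ 0)
        = (fun x : (i : Finset.Iic 0) → S × A => x ⟨0, Finset.mem_Iic.2 le_rfl⟩)
          ∘ Preorder.frestrictLe 0 := rfl
    rw [h2, ← Measure.map_map (by fun_prop) (by fun_prop), h,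
      Measure.map_map (by fun_prop) (by fun_prop)]
    rw [MDP.marginal, Policy.draw, ← Measure.compProd_eq_comp_prod]
    exact Measure.map_id
  | succ t ih =>
    have h := Kernel.map_frestrictLe_trajMeasure_compProd_eq_map_trajMeasure
      (X := fun _ => S × A) (μ₀ := M.ρ ⊗ₘ π.kernel) (κ := M.historyStep π) (a := t)
    have h2 := congrArg Measure.snd h
    rw [Measure.snd_compProd, Measure.snd_map_prodMk (by fun_prop)] at h2
    rw [MDP.marginal, ← Measure.comp_assoc, ← ih]
    refine h2.symm.trans ?_
    rw [MDP.historyStep, ← Kernel.comp_deterministic_eq_comap, ← Measure.comp_assoc,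
      Measure.deterministic_comp_eq_map, Measure.map_map (by fun_prop) (by fun_prop)]
    rfl

theorem MDP.expectedReturn_eq_tsum (π : Policy S μ) :
    M.expectedReturn π = ∑' t, M.γ ^ t * M.rewardAt π t M.ρ := by
  have hm : ∀ t, Measurable fun τ : ℕ → S × A => M.R (τ t).1 (τ t).2 :=
    fun t => M.measurable_R'.comp (measurable_pi_apply t)
  have hR : ∀ t, ∫ τ, M.R (τ t).1 (τ t).2 ∂(M.trajectoryLaw π) = M.rewardAt π t M.ρ := by
    intro t
    rw [MDP.rewardAt, ← M.map_trajectoryLaw, integral_map (measurable_pi_apply t).aemeasurable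
      M.measurable_R'.aestronglyMeasurable]
  have : IsProbabilityMeasure (M.trajectoryLaw π) := by
    unfold MDP.trajectoryLaw; infer_instance
  have hint : ∀ t, Integrable (fun τ : ℕ → S × A => M.γ ^ t * M.R (τ t).1 (τ t).2)
      (M.trajectoryLaw π) := fun t =>
    (Integrable.of_bound (hm t).aestronglyMeasurable M.Rmax
      (Eventually.of_forall fun x => M.abs_R_le _ _)).const_mul _
  have hsum : Summable fun t => ∫ τ, ‖M.γ ^ t * M.R (τ t).1 (τ t).2‖ ∂(M.trajectoryLaw π) := by
    refine Summable.of_nonneg_of_le (fun t => integral_nonneg fun τ => norm_nonneg _) (fun t => ?_)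
      ((summable_geometric_of_lt_one M.γ_nonneg M.γ_lt_one).mul_right M.Rmax)
    refine (integral_mono (hint t).norm (integrable_const (M.γ ^ t * M.Rmax)) fun τ => ?_).trans
      (by simp)
    simp only [norm_mul, norm_pow, Real.norm_eq_abs, abs_of_nonneg M.γ_nonneg]
    gcongr
    · exact pow_nonneg M.γ_nonneg _
    · exact M.abs_R_le _ _
  refine (hasSum_integral_of_summable_integral_norm hint hsum).tsum_eq.symm.trans ?_
  refine tsum_congr fun t => ?_
  rw [integral_const_mul, hR]

end Step

/-! ### Differentiation under the integral sign -/

theorem integrable_count_of_summable_norm {E : Type*} [NormedAddCommGroup E] {f : ℕ → E}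
    (hf : Summable fun t => ‖f t‖) : Integrable f Measure.count := by
  rw [Measure.count]
  exact integrable_sum_measure (fun t => integrable_dirac (by simp)) (by simpa using hf)

theorem integral_count_eq_tsum {E : Type*} [NormedAddCommGroup E] [NormedSpace ℝ E]
    [CompleteSpace E] {f : ℕ → E} (hf : Summable fun t => ‖f t‖) :
    ∫ t, f t ∂Measure.count = ∑' t, f t := by
  rw [integral_countable (integrable_count_of_summable_norm hf)]
  simp [Measure.real]

theorem norm_fderiv_eq_norm_gradient {E : Type*} [NormedAddCommGroup E] [InnerProductSpace ℝ E]
    [CompleteSpace E] (f : E → ℝ) (x : E) : ‖fderiv ℝ f x‖ = ‖(∇ f) x‖ := by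
  rw [← toDual_gradient, LinearIsometryEquiv.norm_map]

section Parametric

variable {E α : Type*} [NormedAddCommGroup E] [InnerProductSpace ℝ E] [FiniteDimensional ℝ E]
  [MeasurableSpace α] {m : Measure α} {f : E → α → ℝ}
  {x₀ : E} {r : ℝ} {g : α → ℝ}

/-- Differentiating once under the integral sign, throughout the ball on which the gradients of the
integrands are controlled by their Lipschitz bound at the centre. -/
theorem hasGradientAt_integral_of_gradient_lip (hfm : ∀ x, Measurable (f x))
    (hfi : ∀ x, Integrable (f x) m) (hfd : ∀ a, Differentiable ℝ fun x => f x a)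
    (hg : Integrable g m) (hf0 : Integrable (fun a => (∇ fun x => f x a) x₀) m)
    (hlip : ∀ᵐ a ∂m, ∀ x ∈ Metric.ball x₀ r,
      ‖(∇ fun x => f x a) x - (∇ fun x => f x a) x₀‖ ≤ g a * ‖x - x₀‖)
    {x : E} (hx : x ∈ Metric.ball x₀ r) :
    HasGradientAt (fun x => ∫ a, f x a ∂m) (∫ a, (∇ fun x => f x a) x ∂m) x := by
  have h := hasFDerivAt_integral_of_dominated_of_fderiv_le (𝕜 := ℝ) (μ := m) (F := f)
    (F' := fun x a => fderiv ℝ (fun x => f x a) x) (x₀ := x) (s := Metric.ball x₀ r)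
    (bound := fun a => ‖(∇ fun x => f x a) x₀‖ + |g a| * r) (Metric.isOpen_ball.mem_nhds hx)
    (Eventually.of_forall fun x => (hfm x).aestronglyMeasurable) (hfi x)
    (measurable_fderiv_of_measurable hfm fun a => hfd a x).aestronglyMeasurable
    (by
      filter_upwards [hlip] with a ha y hy
      rw [norm_fderiv_eq_norm_gradient]
      have h1 := ha y hy
      have h2 := norm_le_norm_add_norm_sub' ((∇ fun x => f x a) y) ((∇ fun x => f x a) x₀)
      rw [mem_ball_iff_norm] at hy
      have h3 : g a * ‖y - x₀‖ ≤ |g a| * r := by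
        gcongr
        exact le_abs_self _
      linarith)
    (hf0.norm.add (hg.abs.mul_const r))
    (Eventually.of_forall fun a y _ => (hfd a y).hasFDerivAt)
  rw [hasGradientAt_iff_hasFDerivAt]
  refine h.congr_fderiv ?_
  have h2 := (InnerProductSpace.toDual ℝ E).toContinuousLinearEquiv.integral_comp_comm
    (μ := m) (fun a => (∇ fun x => f x a) x)
  simpa [toDual_gradient] using h2

/-- Differentiating twice under the integral sign at `x₀`: it suffices that the gradients of the
integrands are Lipschitz at `x₀`, with an integrable constant. -/
theorem differentiableAt_gradient_integral (hr : 0 < r) (hfm : ∀ x, Measurable (f x))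
    (hfi : ∀ x, Integrable (f x) m) (hfd : ∀ a, Differentiable ℝ fun x => f x a)
    (hg : Integrable g m) (hf0 : Integrable (fun a => (∇ fun x => f x a) x₀) m)
    (hlip : ∀ᵐ a ∂m, ∀ x ∈ Metric.ball x₀ r,
      ‖(∇ fun x => f x a) x - (∇ fun x => f x a) x₀‖ ≤ g a * ‖x - x₀‖)
    (hfd2 : ∀ a, DifferentiableAt ℝ (∇ fun x => f x a) x₀) :
    DifferentiableAt ℝ (∇ fun x => ∫ a, f x a ∂m) x₀ := by
  borelize E
  have hgm : ∀ x, Measurable fun a => (∇ fun x => f x a) x :=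
    fun x => measurable_gradient_of_measurable hfm fun a => hfd a x
  have h := (hasFDerivAt_integral_of_dominated_loc_of_lip' (𝕜 := ℝ) (μ := m)
    (F := fun x a => (∇ fun x => f x a) x) (F' := fun a => fderiv ℝ (∇ fun x => f x a) x₀)
    (Metric.ball_mem_nhds x₀ hr) (fun x _ => (hgm x).aestronglyMeasurable) hf0
    (measurable_fderiv_of_measurable hgm hfd2).aestronglyMeasurable hlip hg
    (Eventually.of_forall fun a => (hfd2 a).hasFDerivAt)).2
  refine (h.congr_of_eventuallyEq ?_).differentiableAt
  filter_upwards [Metric.ball_mem_nhds x₀ hr] with x hx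
  exact (hasGradientAt_integral_of_gradient_lip hfm hfi hfd hg hf0 hlip hx).gradient

end Parametric

/-- Local domination of the Hessians allows to differentiate twice under the integral sign a smooth
density multiplied by a bounded function that itself depends on the parameter. -/
theorem IsSmoothDensityFamily.differentiableAt_gradient_integral_mul {d : ℕ} {Ω : Type*}
    [MeasurableSpace Ω] {ν : Measure Ω} {p : EuclideanSpace ℝ (Fin d) → Ω → ℝ} {A B : ℝ≥0}
    (h : IsSmoothDensityFamily ν p A B) {θ₀ : EuclideanSpace ℝ (Fin d)}
    {N : Set (EuclideanSpace ℝ (Fin d))} (hN : N ∈ 𝓝 θ₀) {g : Ω → ℝ} (hg : Integrable g ν)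
    (hdom : ∀ᵐ ω ∂ν, ∀ θ ∈ N, ‖hessian (fun θ => p θ ω) θ‖ ≤ g ω)
    {u : EuclideanSpace ℝ (Fin d) → Ω → ℝ} {C₀ C₁ C₂ : ℝ} (hum : ∀ θ, Measurable (u θ))
    (hu₀ : ∀ θ ω, |u θ ω| ≤ C₀) (hud : ∀ ω, Differentiable ℝ fun θ => u θ ω)
    (hu₁ : ∀ θ ω, ‖(∇ fun θ => u θ ω) θ‖ ≤ C₁)
    (hu₂ : ∀ θ ω, ‖(∇ fun θ => u θ ω) θ - (∇ fun θ => u θ ω) θ₀‖ ≤ C₂ * ‖θ - θ₀‖)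
    (hud₂ : ∀ ω, DifferentiableAt ℝ (∇ fun θ => u θ ω) θ₀) :
    DifferentiableAt ℝ (∇ fun θ => ∫ ω, p θ ω * u θ ω ∂ν) θ₀ := by
  obtain ⟨r', hr', hball⟩ := Metric.mem_nhds_iff.1 hN
  set r := min r' 1 with hr_def
  have hr : 0 < r := lt_min hr' one_pos
  have hrN : Metric.ball θ₀ r ⊆ N := (Metric.ball_subset_ball (min_le_left _ _)).trans hball
  have hgrad : ∀ ω, (∇ fun θ => p θ ω * u θ ω)
      = fun θ => p θ ω • (∇ fun θ => u θ ω) θ + u θ ω • (∇ fun θ => p θ ω) θ :=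
    fun ω => funext fun θ => gradient_fun_mul (h.differentiable ω θ) (hud ω θ)
  have hp0 := (h.integrable_gradient θ₀).norm
  refine differentiableAt_gradient_integral hr
    (g := fun ω => (‖(∇ fun θ => p θ ω) θ₀‖ + g ω) * C₁ + p θ₀ ω * C₂ + C₀ * g ω
      + C₁ * ‖(∇ fun θ => p θ ω) θ₀‖)
    (fun θ => (h.measurable θ).mul (hum θ))
    (fun θ => (h.integrable θ).mul_bdd (hum θ).aestronglyMeasurable
      (Eventually.of_forall (hu₀ θ)))
    (fun ω => (h.differentiable ω).mul (hud ω)) ?_ ?_ ?_ ?_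
  · exact ((((hp0.add hg).mul_const C₁).add ((h.integrable θ₀).mul_const C₂)).add
      (hg.const_mul C₀)).add (hp0.const_mul C₁)
  · simp only [hgrad]
    refine Integrable.add ?_ ?_
    · exact (h.integrable θ₀).smul_bdd C₁
        (measurable_gradient_of_measurable hum fun ω => hud ω θ₀).aestronglyMeasurable
        (Eventually.of_forall (hu₁ θ₀))
    · exact (h.integrable_gradient θ₀).bdd_smul C₀ (hum θ₀).aestronglyMeasurable
        (Eventually.of_forall (hu₀ θ₀))
  · filter_upwards [hdom] with ω hω θ hθ
    have hg0 : 0 ≤ g ω := (norm_nonneg _).trans (hω θ₀ (hrN (Metric.mem_ball_self hr)))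
    have hconv := convex_ball θ₀ r
    have hgp : ∀ y ∈ Metric.ball θ₀ r,
        ‖(∇ fun θ => p θ ω) y - (∇ fun θ => p θ ω) θ₀‖ ≤ g ω * ‖y - θ₀‖ := fun y hy =>
      hconv.norm_image_sub_le_of_norm_fderiv_le (𝕜 := ℝ)
        (fun z _ => h.differentiable_gradient ω z) (fun z hz => hω z (hrN hz))
        (Metric.mem_ball_self hr) hy
    have hp : |p θ ω - p θ₀ ω| ≤ (‖(∇ fun θ => p θ ω) θ₀‖ + g ω) * ‖θ - θ₀‖ := by
      refine hconv.norm_image_sub_le_of_norm_fderiv_le (𝕜 := ℝ) (f := fun θ => p θ ω)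
        (fun z _ => h.differentiable ω z) (fun z hz => ?_) (Metric.mem_ball_self hr) hθ
      rw [norm_fderiv_eq_norm_gradient]
      have h1 := norm_le_norm_add_norm_sub' ((∇ fun θ => p θ ω) z) ((∇ fun θ => p θ ω) θ₀)
      have h2 := hgp z hz
      have h3 : ‖z - θ₀‖ ≤ 1 := by
        rw [mem_ball_iff_norm] at hz
        exact hz.le.trans (min_le_right _ _)
      have h4 : g ω * ‖z - θ₀‖ ≤ g ω := mul_le_of_le_one_right hg0 h3
      linarith
    have hu : |u θ ω - u θ₀ ω| ≤ C₁ * ‖θ - θ₀‖ :=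
      convex_univ.norm_image_sub_le_of_norm_fderiv_le (𝕜 := ℝ) (f := fun θ => u θ ω)
        (fun z _ => hud ω z) (fun z _ => (norm_fderiv_eq_norm_gradient _ _).trans_le (hu₁ z ω))
        (Set.mem_univ _) (Set.mem_univ _)
    have hpos := (h.pos θ₀ ω).le
    have h1 := hgp θ hθ
    have h2 := hu₂ θ ω
    have h3 := hu₁ θ ω
    have h4 := hu₀ θ ω
    simp only [hgrad]
    set P := (∇ fun θ => p θ ω) θ
    set P₀ := (∇ fun θ => p θ ω) θ₀
    set U := (∇ fun θ => u θ ω) θ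
    set U₀ := (∇ fun θ => u θ ω) θ₀
    -- every term of this splitting involves only one increment, and a factor that is controlled
    have e : p θ ω • U + u θ ω • P - (p θ₀ ω • U₀ + u θ₀ ω • P₀)
        = (p θ ω - p θ₀ ω) • U + p θ₀ ω • (U - U₀) + u θ ω • (P - P₀)
          + (u θ ω - u θ₀ ω) • P₀ := by
      simp only [sub_smul, smul_sub]; abel
    rw [e]
    calc _ ≤ ‖(p θ ω - p θ₀ ω) • U‖ + ‖p θ₀ ω • (U - U₀)‖ + ‖u θ ω • (P - P₀)‖
          + ‖(u θ ω - u θ₀ ω) • P₀‖ := norm_add₄_le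
      _ ≤ ((‖P₀‖ + g ω) * ‖θ - θ₀‖) * C₁ + p θ₀ ω * (C₂ * ‖θ - θ₀‖)
          + C₀ * (g ω * ‖θ - θ₀‖) + (C₁ * ‖θ - θ₀‖) * ‖P₀‖ := by
        simp only [norm_smul, Real.norm_eq_abs, abs_of_nonneg hpos]
        gcongr
        exact (abs_nonneg _).trans h4
      _ = _ := by ring
  · intro ω
    rw [hgrad]
    exact ((h.differentiable ω θ₀).smul (hud₂ ω)).add
      ((hud ω θ₀).smul (h.differentiable_gradient ω θ₀))

/-! ### The Hessian of the expected rewards under local domination -/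

section Reward

universe u v

variable {S : Type u} {A : Type v} [MeasurableSpace S] [MeasurableSpace A] {μ : Measure A}
  [SigmaFinite μ] {d : ℕ} {π : EuclideanSpace ℝ (Fin d) → Policy S μ} {G F : ℝ} (M : MDP S A)

theorem MDP.Rmax_nonneg (π : Policy S μ) : 0 ≤ M.Rmax :=
  (abs_nonneg _).trans (M.abs_rewardAt_le π 0 M.ρ)

/-- The constants are uniform in the initial law `ρ`. -/
theorem MDP.rewardAt_smooth (hELS : IsExpectedLipschitzSmooth π G F) (hπ : IsRegularFamily π)
    (t : ℕ) (ρ : Measure S) [IsProbabilityMeasure ρ] :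
    Differentiable ℝ (fun θ => M.rewardAt (π θ) t ρ) ∧
    (∀ θ, ‖(∇ fun θ => M.rewardAt (π θ) t ρ) θ‖ ≤ M.Rmax * (1 + (t + 1) * G ^ 2)) ∧
    ∀ θ θ', ‖(∇ fun θ => M.rewardAt (π θ) t ρ) θ' - (∇ fun θ => M.rewardAt (π θ) t ρ) θ‖
      ≤ M.Rmax * ((t + 1) * (G ^ 2 + F)) * ‖θ' - θ‖ := by
  have := (isSmoothMarginal_marginal M ρ hELS hπ t).differentiable_integral
    M.measurable_R' (M.Rmax_nonneg (π 0)) (fun x => M.abs_R_le x.1 x.2)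
  push_cast [Real.coe_toNNReal _ (sq_nonneg G), Real.coe_toNNReal _ hELS.F_pos.le] at this
  refine ⟨this.1, this.2.1, fun θ θ' => (this.2.2 θ θ').trans (le_of_eq ?_)⟩
  ring

theorem MDP.rewardAt_dirac (π : Policy S μ) (t : ℕ) (s : S) :
    M.rewardAt π t (Measure.dirac s) = ∫ x, M.R x.1 x.2 ∂(M.marginal π t s) := by
  rw [MDP.rewardAt, Measure.dirac_bind (Kernel.measurable _)]

theorem MDP.rewardAt_eq_integral (π : Policy S μ) (t : ℕ) (ρ : Measure S)
    [IsProbabilityMeasure ρ] :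
    M.rewardAt π t ρ = ∫ s, M.rewardAt π t (Measure.dirac s) ∂ρ := by
  simp only [M.rewardAt_dirac]
  rw [MDP.rewardAt, Measure.comp_eq_comp_const_apply, Kernel.integral_comp (M.integrable_R _),
    Kernel.const_apply]

theorem MDP.measurable_rewardAt_kernel {X : Type*} [MeasurableSpace X] (π : Policy S μ) (t : ℕ)
    (κ : Kernel X S) : Measurable fun x => M.rewardAt π t (κ x) := by
  have : (fun x => M.rewardAt π t (κ x))
      = fun x => ∫ y, M.R y.1 y.2 ∂((M.marginal π t ∘ₖ κ) x) := by
    simp only [MDP.rewardAt, Kernel.comp_apply]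
  rw [this]
  exact (M.measurable_R'.stronglyMeasurable.integral_kernel).measurable

theorem Policy.integral_draw (π : Policy S μ) (s : S) {f : S × A → ℝ} (hf : Measurable f) :
    ∫ x, f x ∂(π.draw s) = ∫ a, π.dens s a * f (s, a) ∂μ := by
  have hm : Measurable fun a => π.dens s a := π.measurable_dens.comp measurable_prodMk_left
  have : π.draw s = (π.kernel s).map (Prod.mk s) := by
    rw [Policy.draw, Kernel.prod_apply, Kernel.id_apply, Measure.dirac_prod]
  rw [this, integral_map (by fun_prop) hf.aestronglyMeasurable, Policy.kernel_apply,
    integral_withDensity_eq_integral_toReal_smul hm.ennreal_ofReal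
      (Eventually.of_forall fun _ => ENNReal.ofReal_lt_top)]
  simp only [ENNReal.toReal_ofReal (π.dens_nonneg _ _), smul_eq_mul]

theorem MDP.rewardAt_zero_dirac (π : Policy S μ) (s : S) :
    M.rewardAt π 0 (Measure.dirac s) = ∫ a, π.dens s a * M.R s a ∂μ := by
  rw [M.rewardAt_dirac, MDP.marginal, π.integral_draw s M.measurable_R']

/-- One step of backward induction. -/
theorem MDP.rewardAt_succ_dirac (π : Policy S μ) (t : ℕ) (s : S) :
    M.rewardAt π (t + 1) (Measure.dirac s)
      = ∫ a, π.dens s a * M.rewardAt π t (M.P (s, a)) ∂μ := by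
  rw [M.rewardAt_dirac, M.marginal_succ', ← Kernel.comp_assoc,
    Kernel.integral_comp (M.integrable_R _)]
  simp only [Kernel.comp_apply (M.marginal π t) M.P]
  exact π.integral_draw s (M.measurable_rewardAt_kernel π t M.P)

/-- By induction on `t`, simultaneously for all initial laws. The neighbourhoods and the dominating
functions of the hypothesis may depend on the state; only the Lipschitz constants of
`MDP.rewardAt_smooth`, which do not, are used when states are averaged. -/
theorem MDP.differentiableAt_gradient_rewardAt (hELS : IsExpectedLipschitzSmooth π G F)
    (hπ : IsRegularFamily π) {θ₀ : EuclideanSpace ℝ (Fin d)} (hdom : HessianLocallyDominated π θ₀)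
    (t : ℕ) (ρ : Measure S) [IsProbabilityMeasure ρ] :
    DifferentiableAt ℝ (∇ fun θ => M.rewardAt (π θ) t ρ) θ₀ := by
  -- mixing over the initial state only needs constants that do not depend on that state
  have mix : ∀ t, (∀ s, DifferentiableAt ℝ
      (∇ fun θ => M.rewardAt (π θ) t (Measure.dirac s)) θ₀) →
      ∀ (ρ : Measure S) [IsProbabilityMeasure ρ],
        DifferentiableAt ℝ (∇ fun θ => M.rewardAt (π θ) t ρ) θ₀ := by
    intro t ht ρ _
    have hs := fun s : S => M.rewardAt_smooth hELS hπ t (Measure.dirac s)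
    have hm : ∀ θ, Measurable fun s => M.rewardAt (π θ) t (Measure.dirac s) :=
      fun θ => M.measurable_rewardAt_kernel (π θ) t Kernel.id
    simp only [M.rewardAt_eq_integral _ t ρ]
    exact differentiableAt_gradient_integral one_pos hm
      (fun θ => Integrable.of_bound (hm θ).aestronglyMeasurable M.Rmax
        (Eventually.of_forall fun s => M.abs_rewardAt_le _ _ _))
      (fun s => (hs s).1) (integrable_const (M.Rmax * ((t + 1) * (G ^ 2 + F))))
      (Integrable.of_bound
        (measurable_gradient_of_measurable hm fun s => (hs s).1 θ₀).aestronglyMeasurable _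
        (Eventually.of_forall fun s => (hs s).2.1 θ₀))
      (Eventually.of_forall fun s θ _ => (hs s).2.2 θ₀ θ) ht
  induction t generalizing ρ with
  | zero =>
    refine mix 0 (fun s => ?_) ρ
    obtain ⟨N, hN, g, hg, hd⟩ := hdom s
    simp only [M.rewardAt_zero_dirac]
    have hRm : Measurable fun a => M.R s a := M.measurable_R.comp measurable_prodMk_left
    exact (hELS.isSmoothDensityFamily hπ s).differentiableAt_gradient_integral_mul
      hN hg hd (u := fun _ a => M.R s a) (C₀ := M.Rmax) (C₁ := 0) (C₂ := 0) (fun _ => hRm)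
      (fun _ a => M.abs_R_le s a) (fun a => differentiable_const _) (fun θ a => by simp)
      (fun θ a => by simp) (fun a => by rw [gradient_fun_const']; exact differentiableAt_const _)
  | succ t ih =>
    refine mix (t + 1) (fun s => ?_) ρ
    obtain ⟨N, hN, g, hg, hd⟩ := hdom s
    simp only [M.rewardAt_succ_dirac]
    have hs := fun a : A => M.rewardAt_smooth hELS hπ t (M.P (s, a))
    exact (hELS.isSmoothDensityFamily hπ s).differentiableAt_gradient_integral_mul
      hN hg hd (u := fun θ a => M.rewardAt (π θ) t (M.P (s, a)))
      (fun θ => (M.measurable_rewardAt_kernel (π θ) t M.P).comp measurable_prodMk_left)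
      (fun θ a => M.abs_rewardAt_le _ _ _) (fun a => (hs a).1) (fun θ a => (hs a).2.1 θ)
      (fun θ a => (hs a).2.2 θ₀ θ) (fun a => ih (M.P (s, a)))

theorem MDP.hasSum_succ_mul_pow : HasSum (fun t : ℕ => ((t : ℝ) + 1) * M.γ ^ t)
    (1 / (1 - M.γ) ^ 2) := by
  have hγ : ‖M.γ‖ < 1 := by rw [Real.norm_of_nonneg M.γ_nonneg]; exact M.γ_lt_one
  have h := (hasSum_coe_mul_geometric_of_norm_lt_one hγ).add
    (hasSum_geometric_of_lt_one M.γ_nonneg M.γ_lt_one)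
  have h1 : 1 - M.γ ≠ 0 := (sub_pos.2 M.γ_lt_one).ne'
  have e : M.γ / (1 - M.γ) ^ 2 + (1 - M.γ)⁻¹ = 1 / (1 - M.γ) ^ 2 := by
    field_simp
    ring
  rw [e] at h
  simpa only [add_mul, one_mul] using h

end Reward

/-! ### Smoothness of the expected return -/

theorem mainTheorem7 {S A : Type*} [MeasurableSpace S] [MeasurableSpace A]
    (μ : Measure A) [SigmaFinite μ] (M : MDP S A) {d : ℕ}
    (π : EuclideanSpace ℝ (Fin d) → Policy S μ) (hπ : IsRegularFamily π)
    (G F : ℝ) (hELS : IsExpectedLipschitzSmooth π G F)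
    (J : EuclideanSpace ℝ (Fin d) → ℝ) (hJ : ∀ θ, J θ = M.expectedReturn (π θ))
    (L : ℝ) (hL : L = M.Rmax / (1 - M.γ) ^ 2 * (G ^ 2 + F)) :
    -- `J` is differentiable and its gradient is `L`-Lipschitz
    Differentiable ℝ J ∧
    (∀ θ θ', ‖(∇ J) θ' - (∇ J) θ‖ ≤ L * ‖θ' - θ‖) ∧
    -- the quadratic form of `L`-smoothness
    (∀ θ θ', |J θ' - J θ - inner ℝ ((∇ J) θ) (θ' - θ)| ≤ L / 2 * ‖θ' - θ‖ ^ 2) ∧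
    -- the Hessian of `J` exists almost everywhere, and it exists at each point near which the
    -- Hessians of the densities are dominated
    (∀ᵐ θ, DifferentiableAt ℝ (∇ J) θ) ∧
    (∀ θ, HessianLocallyDominated π θ → DifferentiableAt ℝ (∇ J) θ) ∧
    -- the Hessian is bounded by `L` at every point where it exists
    (∀ θ, DifferentiableAt ℝ (∇ J) θ → ‖hessian J θ‖ ≤ L) := by
  have hR := M.Rmax_nonneg (π 0)
  have hF := hELS.F_pos.le
  have hγ : ∀ t : ℕ, 0 ≤ M.γ ^ t := fun t => pow_nonneg M.γ_nonneg t
  have hsm := fun t => M.rewardAt_smooth hELS hπ t M.ρ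
  -- the series over time is treated as an integral over the counting measure on `ℕ`
  let f : EuclideanSpace ℝ (Fin d) → ℕ → ℝ := fun θ t => M.γ ^ t * M.rewardAt (π θ) t M.ρ
  let w : ℕ → ℝ := fun t => M.Rmax * (G ^ 2 + F) * (((t : ℝ) + 1) * M.γ ^ t)
  have hwsum : HasSum w L := by
    have e : L = M.Rmax * (G ^ 2 + F) * (1 / (1 - M.γ) ^ 2) := by rw [hL]; ring
    rw [e]
    exact M.hasSum_succ_mul_pow.mul_left _
  have hw0 : ∀ t, 0 ≤ w t := fun t => by
    have := hγ t
    positivity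
  have hL0 : 0 ≤ L := hwsum.nonneg hw0
  have hwn : Summable fun t => ‖w t‖ := by
    simpa only [Real.norm_of_nonneg (hw0 _)] using hwsum.summable
  have hwi := integrable_count_of_summable_norm hwn
  have hgeo : Summable fun t : ℕ => M.γ ^ t :=
    summable_geometric_of_lt_one M.γ_nonneg M.γ_lt_one
  have hfn : ∀ θ, Summable fun t => ‖f θ t‖ := fun θ => by
    refine Summable.of_nonneg_of_le (fun t => norm_nonneg _) (fun t => ?_)
      (hgeo.mul_right M.Rmax)
    rw [norm_mul, Real.norm_of_nonneg (hγ t)]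
    refine mul_le_mul_of_nonneg_left ?_ (hγ t)
    exact M.abs_rewardAt_le _ _ _
  have hfgrad : ∀ t, (∇ fun θ => f θ t)
      = fun θ => M.γ ^ t • (∇ fun θ => M.rewardAt (π θ) t M.ρ) θ := fun t => funext fun θ => by
    have := gradient_fun_mul (f := fun _ => M.γ ^ t) (differentiableAt_const _) ((hsm t).1 θ)
    rwa [gradient_fun_const, smul_zero, add_zero] at this
  have hfd : ∀ t, Differentiable ℝ fun θ => f θ t := fun t => (hsm t).1.const_mul _
  have hflip : ∀ t θ θ', ‖(∇ fun θ => f θ t) θ' - (∇ fun θ => f θ t) θ‖ ≤ w t * ‖θ' - θ‖ := by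
    intro t θ θ'
    rw [hfgrad]
    simp only
    rw [← smul_sub, norm_smul, Real.norm_of_nonneg (hγ t)]
    calc _ ≤ M.γ ^ t * (M.Rmax * ((t + 1) * (G ^ 2 + F)) * ‖θ' - θ‖) := by
          gcongr
          · exact hγ t
          · exact (hsm t).2.2 θ θ'
      _ = _ := by simp only [w]; ring
  have hfgi : ∀ θ, Integrable (fun t => (∇ fun θ => f θ t) θ) Measure.count := fun θ => by
    refine integrable_count_of_summable_norm (Summable.of_nonneg_of_le (fun t => norm_nonneg _)
      (fun t => ?_) ((hgeo.mul_left M.Rmax).add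
        (M.hasSum_succ_mul_pow.summable.mul_left (M.Rmax * G ^ 2))))
    rw [hfgrad, norm_smul, Real.norm_of_nonneg (hγ t)]
    calc _ ≤ M.γ ^ t * (M.Rmax * (1 + (t + 1) * G ^ 2)) := by
          gcongr
          · exact hγ t
          · exact (hsm t).2.1 θ
      _ = _ := by ring
  have hfm : ∀ θ, Measurable (f θ) := fun θ => measurable_of_countable _
  have hfi : ∀ θ, Integrable (f θ) Measure.count :=
    fun θ => integrable_count_of_summable_norm (hfn θ)
  have hJf : J = fun θ => ∫ t, f θ t ∂Measure.count := funext fun θ => by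
    rw [hJ, M.expectedReturn_eq_tsum, integral_count_eq_tsum (hfn θ)]
  have hJg : ∀ θ, HasGradientAt J (∫ t, (∇ fun θ => f θ t) θ ∂Measure.count) θ := fun θ => by
    rw [hJf]
    exact hasGradientAt_integral_of_gradient_lip hfm hfi hfd hwi (hfgi θ)
      (Eventually.of_forall fun t θ' _ => hflip t θ θ') (Metric.mem_ball_self one_pos)
  have hJd : Differentiable ℝ J := fun θ => (hJg θ).differentiableAt
  have hJlip : ∀ θ θ', ‖(∇ J) θ' - (∇ J) θ‖ ≤ L * ‖θ' - θ‖ := fun θ θ' => by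
    rw [(hJg θ).gradient, (hJg θ').gradient, ← integral_sub (hfgi θ') (hfgi θ)]
    refine (norm_integral_le_of_norm_le (hwi.mul_const ‖θ' - θ‖)
      (Eventually.of_forall fun t => hflip t θ θ')).trans (le_of_eq ?_)
    rw [integral_mul_const, integral_count_eq_tsum hwn, hwsum.tsum_eq]
  have hLip : LipschitzWith L.toNNReal (∇ J) := LipschitzWith.of_dist_le_mul fun θ' θ => by
    rw [dist_eq_norm, dist_eq_norm, Real.coe_toNNReal _ hL0]
    exact hJlip θ θ'
  refine ⟨hJd, hJlip, abs_sub_sub_inner_gradient_le hJd hJlip, hLip.ae_differentiableAt,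
    fun θ hθ => ?_, fun θ _ => ?_⟩
  · rw [hJf]
    refine differentiableAt_gradient_integral one_pos hfm hfi hfd hwi (hfgi θ)
      (Eventually.of_forall fun t θ' _ => hflip t θ θ') fun t => ?_
    rw [hfgrad]
    exact (M.differentiableAt_gradient_rewardAt hELS hπ hθ t M.ρ).fun_const_smul _
  · exact (norm_fderiv_le_of_lipschitz ℝ hLip).trans_eq (Real.coe_toNNReal _ hL0)

end
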